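/- Regard a complex Banach space $X$ as a metric structure of continuous first-order logic: its universe is the closed unit ball $B(X)$ with $d(x,y)=\|x-y\|$, and for every $n$ and every $\bar a\in\mathbb{C}^n$ it has the predicate $s_{\bar a}(\bar x)=\|\sum_i a_ix_i\|$ and the function $\sigma_{\bar a}(\bar x)$ whose value is $y=\sum_i a_ix_i$ if $\|y\|\le 1$ and $y/\|y\|$ otherwise; there is also a constant $\mathbf 0$. Let $T$ be the theory of (the unit ball of) an infinite-dimensional complex Hilbert space. Then the following hold. 1. $T$ is inseparably categorical: for every uncountable cardinal $\kappa$, $T$ has a model of density character $\kappa$, and any two models of $T$ of density character $\kappa$ are isomorphic. 2. Let $\mathfrak{C}$ be a monster model of $T$, that is, a $\kappa$-saturated and strongly $\kappa$-homogeneous model for an uncountable cardinal $\kappa$, and let $A\subseteq\mathfrak{C}$ be small, i.e. $|A|<\kappa$. For every partial type $\Sigma(x)$ over $A$ (a set of conditions $\varphi(x)=0$ with $\varphi$ a formula with parameters from $A$), the set of realizations $\Sigma(\mathfrak{C})$ is not an infinite-dimensional indiscernible subspace over $\varnothing$. Here a set $S\subseteq\mathfrak{C}$ is called an indiscernible subspace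 over $\varnothing$ if it is the unit ball of a real subspace (it contains $\mathbf 0$ and is closed under $\sigma_{\bar a}$ for all real tuples $\bar a$) and, for all $n$ and all $n$-tuples $\bar b,\bar c$ in $S$, the tuples $\bar b$ and $\bar c$ have the same type over $\varnothing$ if and only if $\bar b\cong\bar c$, meaning that $\|b_i-b_j\|=\|c_i-c_j\|$ and $\|b_i\|=\|c_i\|$ for all $i,j<n$. It is infinite-dimensional if it contains arbitrarily long tuples that are linearly independent over $\mathbb{R}$. -/

import Mathlib

open Cardinal

universe u v w w'

/-! ### Continuous first-order logic -/

/-- A signature of continuous logic (one-sorted): function and predicate symbols with arities, a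
bound on the metric, a bound on the values of each predicate, and moduli of uniform continuity. -/
structure MetricLanguage : Type (max u v + 1) where
  Func : ℕ → Type u
  Pred : ℕ → Type v
  diam : ℝ
  predBound : ∀ {n : ℕ}, Pred n → ℝ
  funcModulus : ∀ {n : ℕ}, Func n → ℝ → ℝ
  predModulus : ∀ {n : ℕ}, Pred n → ℝ → ℝ
  funcModulus_pos : ∀ {n : ℕ} (f : Func n) (ε : ℝ), 0 < ε → 0 < funcModulus f ε
  predModulus_pos : ∀ {n : ℕ} (P : Pred n) (ε : ℝ), 0 < ε → 0 < predModulus P ε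

namespace MetricLanguage

/-- A metric structure for `L`: a nonempty complete bounded metric space with interpretations of
the function and predicate symbols that obey the bounds and moduli of `L`. -/
class Structure (L : MetricLanguage.{u, v}) (M : Type w) [MetricSpace M] where
  complete : CompleteSpace M
  nonempty : Nonempty M
  dist_le : ∀ x y : M, dist x y ≤ L.diam
  funMap : ∀ {n : ℕ}, L.Func n → (Fin n → M) → M
  predMap : ∀ {n : ℕ}, L.Pred n → (Fin n → M) → ℝ
  predMap_bound : ∀ {n : ℕ} (P : L.Pred n) (x : Fin n → M), |predMap P x| ≤ L.predBound P
  funMap_modulus : ∀ {n : ℕ} (f : L.Func n) (ε : ℝ), 0 < ε → ∀ x y : Fin n → M,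
    (∀ i, dist (x i) (y i) < L.funcModulus f ε) → dist (funMap f x) (funMap f y) ≤ ε
  predMap_modulus : ∀ {n : ℕ} (P : L.Pred n) (ε : ℝ), 0 < ε → ∀ x y : Fin n → M,
    (∀ i, dist (x i) (y i) < L.predModulus P ε) → |predMap P x - predMap P y| ≤ ε

/-- Terms with variables in `α`. -/
inductive Term (L : MetricLanguage.{u, v}) (α : Type w) : Type (max u w)
  | var : α → Term L α
  | func : ∀ {n : ℕ}, L.Func n → (Fin n → Term L α) → Term L α

/-- Formulas with free variables in `α` and, in addition, in `Fin n`. The connectives are all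
continuous functions `ℝᵏ → ℝ`; the quantifiers are `sup` and `inf` over the last variable of
`Fin (n + 1)`. -/
inductive BoundedFormula (L : MetricLanguage.{u, v}) (α : Type w) : ℕ → Type (max u v w)
  | dist : ∀ {n : ℕ}, L.Term (α ⊕ Fin n) → L.Term (α ⊕ Fin n) → BoundedFormula L α n
  | pred : ∀ {n k : ℕ}, L.Pred k → (Fin k → L.Term (α ⊕ Fin n)) → BoundedFormula L α n
  | conn : ∀ {n k : ℕ}, C(Fin k → ℝ, ℝ) → (Fin k → BoundedFormula L α n) → BoundedFormula L α n
  | sup : ∀ {n : ℕ}, BoundedFormula L α (n + 1) → BoundedFormula L α n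
  | inf : ∀ {n : ℕ}, BoundedFormula L α (n + 1) → BoundedFormula L α n

/-- Formulas with free variables in `α`. -/
abbrev Formula (L : MetricLanguage.{u, v}) (α : Type w) : Type (max u v w) := L.BoundedFormula α 0

/-- Formulas without free variables. -/
abbrev Sentence (L : MetricLanguage.{u, v}) : Type (max u v) := L.Formula Empty

/-- A theory is a set of closed conditions `φ = 0`, with `φ` a sentence. -/
abbrev Theory (L : MetricLanguage.{u, v}) : Type (max u v) := Set L.Sentence

variable {L : MetricLanguage.{u, v}}

/-- The value of a term under an assignment. -/
def Term.realize {M : Type w} [MetricSpace M] [L.Structure M] {α : Type w'} (a : α → M) :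
    L.Term α → M
  | .var x => a x
  | .func f ts => Structure.funMap f fun i => (ts i).realize a

/-- The value of a formula under an assignment. -/
noncomputable def BoundedFormula.realize {M : Type w} [MetricSpace M] [L.Structure M]
    {α : Type w'} (a : α → M) : ∀ {n : ℕ}, L.BoundedFormula α n → (Fin n → M) → ℝ
  | _, .dist t₁ t₂, xs => Dist.dist (t₁.realize (Sum.elim a xs)) (t₂.realize (Sum.elim a xs))
  | _, .pred P ts, xs => Structure.predMap P fun i => (ts i).realize (Sum.elim a xs)
  | _, .conn g φs, xs => g fun i => (φs i).realize a xs
  | _, .sup φ, xs => ⨆ x : M, φ.realize a (Fin.snoc xs x)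
  | _, .inf φ, xs => ⨅ x : M, φ.realize a (Fin.snoc xs x)

/-- The values of a formula are bounded, so that the suprema and infima above are genuine. -/
theorem BoundedFormula.exists_abs_realize_le {M : Type w} [MetricSpace M] [L.Structure M]
    {α : Type w'} (a : α → M) {n : ℕ} (φ : L.BoundedFormula α n) :
    ∃ B : ℝ, ∀ xs : Fin n → M, |φ.realize a xs| ≤ B := by
  have : Nonempty M := Structure.nonempty L
  induction φ with
  | dist t₁ t₂ =>
    refine ⟨L.diam, fun xs => ?_⟩
    simp only [realize, abs_of_nonneg dist_nonneg]
    exact Structure.dist_le _ _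
  | pred P ts => exact ⟨L.predBound P, fun xs => Structure.predMap_bound P _⟩
  | conn g φs ih =>
    choose B hB using ih
    obtain ⟨C, hC⟩ := (isCompact_univ_pi fun i => isCompact_Icc (a := -B i) (b := B i)).exists_bound_of_continuousOn
      g.continuous.continuousOn
    refine ⟨C, fun xs => hC _ fun i _ => ?_⟩
    exact abs_le.1 (hB i xs)
  | sup φ ih =>
    obtain ⟨B, hB⟩ := ih
    refine ⟨B, fun xs => abs_le.2 ⟨?_, ciSup_le fun x => (abs_le.1 (hB _)).2⟩⟩
    have hb : BddAbove (Set.range fun x : M => φ.realize a (Fin.snoc xs x : Fin _ → M)) :=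
      ⟨B, by rintro _ ⟨x, rfl⟩; exact (abs_le.1 (hB _)).2⟩
    exact (abs_le.1 (hB _)).1.trans (le_ciSup hb (Classical.arbitrary M))
  | inf φ ih =>
    obtain ⟨B, hB⟩ := ih
    refine ⟨B, fun xs => abs_le.2 ⟨le_ciInf fun x => (abs_le.1 (hB _)).1, ?_⟩⟩
    have hb : BddBelow (Set.range fun x : M => φ.realize a (Fin.snoc xs x : Fin _ → M)) :=
      ⟨-B, by rintro _ ⟨x, rfl⟩; exact (abs_le.1 (hB _)).1⟩
    exact (ciInf_le hb (Classical.arbitrary M)).trans (abs_le.1 (hB _)).2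

/-- The value of a formula without bound variables. -/
noncomputable def Formula.eval {M : Type w} [MetricSpace M] [L.Structure M] {α : Type w'}
    (φ : L.Formula α) (a : α → M) : ℝ :=
  BoundedFormula.realize a φ Fin.elim0

/-- The value of a sentence in a structure. -/
noncomputable def Sentence.eval (φ : L.Sentence) (M : Type w) [MetricSpace M] [L.Structure M] : ℝ :=
  Formula.eval (M := M) φ Empty.elim

/-- The theory of a structure. -/
def theoryOf (L : MetricLanguage.{u, v}) (M : Type w) [MetricSpace M] [L.Structure M] : L.Theory :=
  {φ | Sentence.eval φ M = 0}

/-- `M` is a model of `T`. -/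
def Theory.IsModel (T : L.Theory) (M : Type w) [MetricSpace M] [L.Structure M] : Prop :=
  ∀ φ ∈ T, Sentence.eval φ M = 0

/-- Isomorphisms of metric structures: surjective isometries that commute with the function symbols
and preserve the values of the predicate symbols. -/
structure Iso (L : MetricLanguage.{u, v}) (M : Type w) (N : Type w') [MetricSpace M] [MetricSpace N]
    [L.Structure M] [L.Structure N] extends M ≃ᵢ N where
  map_fun : ∀ {n : ℕ} (f : L.Func n) (x : Fin n → M),
    toFun (Structure.funMap f x) = Structure.funMap f fun i => toFun (x i)
  map_pred : ∀ {n : ℕ} (P : L.Pred n) (x : Fin n → M),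
    Structure.predMap P (fun i => toFun (x i)) = Structure.predMap P x

/-- The density character of a space: the least cardinality of a dense subset. -/
noncomputable def densityCharacter (X : Type w) [TopologicalSpace X] : Cardinal.{w} :=
  sInf {κ | ∃ s : Set X, Dense s ∧ #s = κ}

/-- `T` has, up to isomorphism, exactly one model in each uncountable density character. -/
def Theory.InseparablyCategorical (T : L.Theory) : Prop :=
  ∀ κ : Cardinal.{w}, ℵ₀ < κ →
    (∃ (M : Type w) (_ : MetricSpace M) (_ : L.Structure M),
      T.IsModel M ∧ densityCharacter M = κ) ∧
    ∀ (M N : Type w) [MetricSpace M] [MetricSpace N] [L.Structure M] [L.Structure N],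
      T.IsModel M → T.IsModel N → densityCharacter M = κ → densityCharacter N = κ →
        Nonempty (L.Iso M N)

section Types

variable {M : Type w} [MetricSpace M] [L.Structure M]

/-- The value of a formula with parameters from `A` at a tuple `b`. -/
noncomputable def evalOver {A : Set M} {n : ℕ} (φ : L.Formula (A ⊕ Fin n)) (b : Fin n → M) : ℝ :=
  φ.eval (Sum.elim (fun a : A => (a : M)) b)

/-- A partial type over `A` in one variable: a set of conditions `φ(x) = 0`, where `φ` is a formula
with parameters from `A`. (Consistency is not required.) -/
abbrev PartialType (L : MetricLanguage.{u, v}) {M : Type w} (A : Set M) : Type (max u v w) :=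
  Set (L.Formula (A ⊕ Fin 1))

/-- The set of realizations of a partial type. -/
def PartialType.realizations {A : Set M} (p : PartialType L A) : Set M :=
  {x | ∀ φ ∈ p, evalOver φ (fun _ => x) = 0}

/-- `b ≡_A c`: the tuples `b` and `c` have the same complete type over `A`. -/
def SameType (L : MetricLanguage.{u, v}) {M : Type w} [MetricSpace M] [L.Structure M]
    (A : Set M) {n : ℕ} (b c : Fin n → M) : Prop :=
  ∀ φ : L.Formula (A ⊕ Fin n), evalOver φ b = evalOver φ c

/-- `M` is `κ`-saturated: every partial type over fewer than `κ` parameters which is finitely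
approximately satisfiable in `M` is realized in `M`. -/
def IsSaturated (L : MetricLanguage.{u, v}) (κ : Cardinal.{w}) (M : Type w) [MetricSpace M]
    [L.Structure M] : Prop :=
  ∀ A : Set M, #A < κ → ∀ p : PartialType L A,
    (∀ s : Finset (L.Formula (A ⊕ Fin 1)), (s : Set (L.Formula (A ⊕ Fin 1))) ⊆ p →
      ∀ ε : ℝ, 0 < ε → ∃ x : M, ∀ φ ∈ s, |evalOver φ (fun _ => x)| ≤ ε) →
    p.realizations.Nonempty

/-- `M` is strongly `κ`-homogeneous: every elementary map from a subset of cardinality less than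
`κ` into `M` extends to an automorphism of `M`. -/
def IsStronglyHomogeneous (L : MetricLanguage.{u, v}) (κ : Cardinal.{w}) (M : Type w)
    [MetricSpace M] [L.Structure M] : Prop :=
  ∀ A : Set M, #A < κ → ∀ f : A → M,
    (∀ φ : L.Formula A, φ.eval f = φ.eval (fun a : A => (a : M))) →
    ∃ g : L.Iso M M, ∀ a : A, g.toFun (a : M) = f a

/-- `M` is a monster model of `T` for the uncountable cardinal `κ`; sets of cardinality less than
`κ` are then called small. -/
structure Theory.IsMonster (T : L.Theory) (κ : Cardinal.{w}) (M : Type w) [MetricSpace M]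
    [L.Structure M] : Prop where
  isModel : T.IsModel M
  uncountable : ℵ₀ < κ
  isSaturated : IsSaturated L κ M
  isStronglyHomogeneous : IsStronglyHomogeneous L κ M

end Types

end MetricLanguage

/-! ### Complex Banach spaces as metric structures -/

/-- Function symbols: the constant `0` and truncated linear combinations `σ_a`. -/
inductive BanachFunc : ℕ → Type
  | zero : BanachFunc 0
  | comb : ∀ {n : ℕ}, (Fin n → ℂ) → BanachFunc n

/-- The language of (unit balls of) complex Banach spaces. The predicate symbol indexed by
`a : Fin n → ℂ` is `s_a(x) = ‖∑ aᵢ xᵢ‖`. -/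
noncomputable def complexBanach : MetricLanguage.{0, 0} where
  Func := BanachFunc
  Pred n := Fin n → ℂ
  diam := 2
  predBound a := ∑ i, ‖a i‖
  funcModulus f ε := match f with
    | .zero => ε
    | .comb a => ε / (2 * (∑ i, ‖a i‖ + 1))
  predModulus a ε := ε / (∑ i, ‖a i‖ + 1)
  funcModulus_pos f ε hε := by
    cases f with
    | zero => exact hε
    | comb a => positivity
  predModulus_pos a ε hε := by positivity

/-- The closed unit ball of `X`, as a type. -/
abbrev UnitBall (X : Type w) [NormedAddCommGroup X] : Type w := Metric.closedBall (0 : X) 1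

section UnitBall

variable {X : Type w} [NormedAddCommGroup X] [NormedSpace ℂ X]

/-- The radial retraction of `X` onto its closed unit ball: `y` if `‖y‖ ≤ 1`, else `y / ‖y‖`. -/
noncomputable def radial (y : X) : X := (((max 1 ‖y‖)⁻¹ : ℝ) : ℂ) • y

theorem radial_of_norm_le {y : X} (h : ‖y‖ ≤ 1) : radial y = y := by
  simp [radial, max_eq_left h]

theorem radial_of_one_le_norm {y : X} (h : 1 ≤ ‖y‖) : radial y = ((‖y‖⁻¹ : ℝ) : ℂ) • y := by
  simp [radial, max_eq_right h]

theorem norm_radial_le (y : X) : ‖radial y‖ ≤ 1 := by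
  have h1 : (0 : ℝ) < max 1 ‖y‖ := lt_of_lt_of_le one_pos (le_max_left _ _)
  rw [radial, norm_smul, Complex.norm_real, Real.norm_of_nonneg (inv_nonneg.2 h1.le),
    inv_mul_le_iff₀ h1, mul_one]
  exact le_max_right _ _

theorem norm_radial_sub_le (y z : X) : ‖radial y - radial z‖ ≤ 2 * ‖y - z‖ := by
  have ha1 : 1 ≤ max 1 ‖y‖ := le_max_left _ _
  have hb1 : 1 ≤ max 1 ‖z‖ := le_max_left _ _
  have hbz : ‖z‖ ≤ max 1 ‖z‖ := le_max_right _ _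
  have hab : |max 1 ‖z‖ - max 1 ‖y‖| ≤ ‖y - z‖ := by
    rw [norm_sub_rev y z, max_comm 1, max_comm 1]
    exact (abs_max_sub_max_le_abs _ _ _).trans (abs_norm_sub_norm_le z y)
  unfold radial
  generalize max 1 ‖y‖ = a at *
  generalize max 1 ‖z‖ = b at *
  have ha : 0 < a := by linarith
  have hb : 0 < b := by linarith
  have e : ((a⁻¹ : ℝ) : ℂ) • y - ((b⁻¹ : ℝ) : ℂ) • z
      = ((a⁻¹ : ℝ) : ℂ) • (y - z) + ((a⁻¹ - b⁻¹ : ℝ) : ℂ) • z := by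
    push_cast
    module
  have h1 : a⁻¹ ≤ 1 := inv_le_one_of_one_le₀ ha1
  have h2 : |a⁻¹ - b⁻¹| * ‖z‖ ≤ ‖y - z‖ := by
    have : a⁻¹ - b⁻¹ = (b - a) * (a⁻¹ * b⁻¹) := by field_simp
    rw [this, abs_mul, abs_of_pos (by positivity : 0 < a⁻¹ * b⁻¹)]
    have h3 : b⁻¹ * ‖z‖ ≤ 1 := by
      rw [inv_mul_le_iff₀ hb, mul_one]; exact hbz
    have h4 : a⁻¹ * (b⁻¹ * ‖z‖) ≤ 1 := mul_le_one₀ h1 (by positivity) h3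
    calc |b - a| * (a⁻¹ * b⁻¹) * ‖z‖ = |b - a| * (a⁻¹ * (b⁻¹ * ‖z‖)) := by ring
      _ ≤ |b - a| * 1 := by gcongr
      _ ≤ ‖y - z‖ := by rw [mul_one]; exact hab
  rw [e]
  refine (norm_add_le _ _).trans ?_
  rw [norm_smul, norm_smul, Complex.norm_real, Complex.norm_real, Real.norm_eq_abs,
    Real.norm_eq_abs, abs_of_pos (inv_pos.2 ha)]
  have : a⁻¹ * ‖y - z‖ ≤ 1 * ‖y - z‖ := by gcongr
  linarith

theorem norm_sum_smul_sub_le {n : ℕ} (a : Fin n → ℂ) (x y : Fin n → X) {δ : ℝ}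
    (h : ∀ i, ‖x i - y i‖ ≤ δ) :
    ‖∑ i, a i • x i - ∑ i, a i • y i‖ ≤ (∑ i, ‖a i‖) * δ := by
  rw [← Finset.sum_sub_distrib, Finset.sum_mul]
  refine norm_sum_le_of_le _ fun i _ => ?_
  rw [← smul_sub, norm_smul]
  exact mul_le_mul_of_nonneg_left (h i) (norm_nonneg _)

/-- The closed unit ball of a complex Banach space as a metric structure. -/
noncomputable instance unitBallStructure [CompleteSpace X] :
    complexBanach.Structure (UnitBall X) where
  complete := Metric.isClosed_closedBall.completeSpace_coe
  nonempty := ⟨⟨0, by simp⟩⟩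
  dist_le x y := by
    have hx := mem_closedBall_zero_iff.1 x.2
    have hy := mem_closedBall_zero_iff.1 y.2
    have := norm_sub_le (x : X) y
    rw [Subtype.dist_eq, dist_eq_norm]
    change _ ≤ (2 : ℝ)
    linarith
  funMap f x := match f with
    | .zero => ⟨0, by simp⟩
    | .comb a => ⟨radial (∑ i, a i • (x i : X)), mem_closedBall_zero_iff.2 (norm_radial_le _)⟩
  predMap a x := ‖∑ i, a i • (x i : X)‖
  predMap_bound a x := by
    rw [abs_norm]
    refine norm_sum_le_of_le _ fun i _ => ?_
    rw [norm_smul]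
    exact mul_le_of_le_one_right (norm_nonneg _) (mem_closedBall_zero_iff.1 (x i).2)
  funMap_modulus f ε hε x y h := by
    cases f with
    | zero => simpa using hε.le
    | comb a =>
      have hS : 0 ≤ ∑ i, ‖a i‖ := Finset.sum_nonneg fun i _ => norm_nonneg _
      have h1 := norm_sum_smul_sub_le a (fun i => (x i : X)) (fun i => (y i : X))
        (δ := ε / (2 * (∑ i, ‖a i‖ + 1))) fun i => by
          rw [← dist_eq_norm, ← Subtype.dist_eq]; exact (h i).le
      rw [Subtype.dist_eq, dist_eq_norm]
      refine (norm_radial_sub_le _ _).trans ?_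
      calc _ ≤ 2 * ((∑ i, ‖a i‖) * (ε / (2 * (∑ i, ‖a i‖ + 1)))) := by gcongr
        _ ≤ 2 * ((∑ i, ‖a i‖ + 1) * (ε / (2 * (∑ i, ‖a i‖ + 1)))) := by gcongr; linarith
        _ = ε := by field_simp
  predMap_modulus a ε hε x y h := by
    have hS : 0 ≤ ∑ i, ‖a i‖ := Finset.sum_nonneg fun i _ => norm_nonneg _
    have h1 := norm_sum_smul_sub_le a (fun i => (x i : X)) (fun i => (y i : X))
      (δ := ε / (∑ i, ‖a i‖ + 1)) fun i => by
        rw [← dist_eq_norm, ← Subtype.dist_eq]; exact (h i).le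
    refine (abs_norm_sub_norm_le _ _).trans (h1.trans ?_)
    calc _ ≤ (∑ i, ‖a i‖ + 1) * (ε / (∑ i, ‖a i‖ + 1)) := by gcongr; linarith
      _ = ε := by field_simp

end UnitBall

/-! ### Indiscernible subspaces -/

section Indiscernible

open MetricLanguage

variable {M : Type w} [MetricSpace M] [complexBanach.Structure M]

/-- The interpretation of the constant `0`. -/
noncomputable def ballZero (M : Type w) [MetricSpace M] [complexBanach.Structure M] : M :=
  Structure.funMap (L := complexBanach) BanachFunc.zero Fin.elim0

/-- The interpretation of `σ_a` for a tuple `a` of real scalars. -/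
noncomputable def realComb {n : ℕ} (a : Fin n → ℝ) (x : Fin n → M) : M :=
  Structure.funMap (L := complexBanach) (BanachFunc.comb fun i => (a i : ℂ)) x

/-- The interpretation of `s_a`, the norm of a linear combination, for real scalars. -/
noncomputable def realCombNorm {n : ℕ} (a : Fin n → ℝ) (x : Fin n → M) : ℝ :=
  Structure.predMap (L := complexBanach) (fun i => (a i : ℂ)) x

/-- `S` is (the unit ball of) a real subspace: it contains `0` and every real linear combination
of its elements, truncated to the unit ball. See `isRealSubspace_iff`. -/
structure IsRealSubspace (S : Set M) : Prop where
  zero_mem : ballZero M ∈ S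
  comb_mem : ∀ {n : ℕ} (a : Fin n → ℝ) (x : Fin n → M), (∀ i, x i ∈ S) → realComb a x ∈ S

/-- `S` contains arbitrarily long tuples that are linearly independent over `ℝ`.
See `isInfiniteDimensional_iff`. -/
def IsInfiniteDimensional (S : Set M) : Prop :=
  ∀ n : ℕ, ∃ x : Fin n → M, (∀ i, x i ∈ S) ∧ ∀ a : Fin n → ℝ, realCombNorm a x = 0 → a = 0

/-- Congruence of tuples: all distances between entries, and between entries and `0`, agree. -/
def IsCongruent {n : ℕ} (b c : Fin n → M) : Prop :=
  (∀ i j, dist (b i) (b j) = dist (c i) (c j)) ∧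
    ∀ i, dist (b i) (ballZero M) = dist (c i) (ballZero M)

/-- `S` is (the unit ball of) an indiscernible subspace over `A`. -/
structure IsIndiscernibleSubspace (A S : Set M) : Prop extends IsRealSubspace S where
  sameType_iff : ∀ {n : ℕ} (b c : Fin n → M), (∀ i, b i ∈ S) → (∀ i, c i ∈ S) →
    (SameType complexBanach A b c ↔ IsCongruent b c)

variable {X : Type w} [NormedAddCommGroup X] [NormedSpace ℂ X] [CompleteSpace X]

theorem coe_ballZero : ((ballZero (UnitBall X) : UnitBall X) : X) = 0 := rfl

theorem coe_realComb {n : ℕ} (a : Fin n → ℝ) (x : Fin n → UnitBall X) :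
    ((realComb a x : UnitBall X) : X) = radial (∑ i, a i • (x i : X)) := rfl

theorem realCombNorm_eq {n : ℕ} (a : Fin n → ℝ) (x : Fin n → UnitBall X) :
    realCombNorm a x = ‖∑ i, a i • (x i : X)‖ := rfl

/-- In the unit ball of `X`, the sets satisfying `IsRealSubspace` are exactly the unit balls of the
real subspaces of `X`. -/
theorem isRealSubspace_iff (S : Set (UnitBall X)) :
    IsRealSubspace S ↔ ∃ V : Submodule ℝ X, S = {x : UnitBall X | (x : X) ∈ V} := by
  constructor
  · intro h
    refine ⟨Submodule.span ℝ (Subtype.val '' S), Set.Subset.antisymm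
      (fun x hx => Submodule.subset_span ⟨x, hx, rfl⟩) fun x hx => ?_⟩
    obtain ⟨n, a, g, hg⟩ := Submodule.mem_span_set'.1 (show (x : X) ∈ _ from hx)
    choose y hy hyg using fun i => (g i).2
    have : x = realComb a y := by
      apply Subtype.ext
      rw [coe_realComb]
      simp only [hyg, hg]
      exact (radial_of_norm_le (mem_closedBall_zero_iff.1 x.2)).symm
    rw [this]
    exact h.comb_mem a y hy
  · rintro ⟨V, rfl⟩
    refine ⟨V.zero_mem, fun a x hx => ?_⟩
    change ((realComb a x : UnitBall X) : X) ∈ V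
    rw [coe_realComb, radial, Complex.coe_smul]
    exact V.smul_mem _ (V.sum_mem fun i _ => V.smul_mem _ (hx i))

/-- For the unit ball of a real subspace `V` of `X`, `IsInfiniteDimensional` means that `V` is
infinite-dimensional over `ℝ`. -/
theorem isInfiniteDimensional_iff (V : Submodule ℝ X) :
    IsInfiniteDimensional {x : UnitBall X | (x : X) ∈ V} ↔ ¬ FiniteDimensional ℝ V := by
  constructor
  · intro h hV
    obtain ⟨x, hx, hi⟩ := h (Module.finrank ℝ V + 1)
    have hl : LinearIndependent ℝ (fun i => (⟨x i, hx i⟩ : V)) := by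
      rw [Fintype.linearIndependent_iff]
      intro a ha
      refine fun i => congrFun (hi a ?_) i
      rw [realCombNorm_eq, norm_eq_zero]
      simpa using congrArg Subtype.val ha
    simpa using hl.fintype_card_le_finrank
  · intro hV n
    obtain ⟨s, hs⟩ : ∃ s : Fin n → V, LinearIndependent ℝ s := by
      rw [FiniteDimensional, ← Module.rank_lt_aleph0_iff, not_lt] at hV
      obtain ⟨t, ht, hl⟩ := (le_rank_iff_exists_linearIndependent_finset (K := ℝ) (V := V) (n := n)).1
        ((Cardinal.natCast_lt_aleph0 (n := n)).le.trans hV)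
      exact ⟨_, hl.comp _ (t.equivFinOfCardEq ht).symm.injective⟩
    have hn : ∀ i, ‖(s i : X)‖ ≠ 0 := fun i => by
      simpa using hs.ne_zero i
    refine ⟨fun i => ⟨(‖(s i : X)‖⁻¹ : ℝ) • (s i : X), ?_⟩, fun i => V.smul_mem _ (s i).2, ?_⟩
    · rw [mem_closedBall_zero_iff, norm_smul, norm_inv, norm_norm, inv_mul_cancel₀ (hn i)]
    · intro a ha
      rw [realCombNorm_eq, norm_eq_zero] at ha
      have := Fintype.linearIndependent_iff.1 hs (fun i => a i * ‖(s i : X)‖⁻¹) (by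
        apply Subtype.ext
        simpa [mul_smul] using ha)
      funext i
      simpa [hn i] using this i

end Indiscernible

/-! Everything rests on the Gram matrix. By polarization, the inner product of two elements of the
ball is a continuous function of finitely many norm predicates. A closed relation among values of
formulas that holds throughout the ball of `H` is itself a condition of the theory, because the
distance to a closed set is a continuous connective (`mem_of_isClosed`). So in an arbitrary model
the polarized form is Hermitian and positive. It is then the Gram kernel of a total family in a
Hilbert space `K`, and the transferred law for `σ_a` makes the model the whole unit ball of `K`
(`exists_iso_unitBall`).

Conversely, a back-and-forth argument shows that in infinite dimension the value of a formula
depends only on the Gram matrix of the tuple (`realize_eq_of_gram_eq`), so all infinite-dimensional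
Hilbert spaces give models. An uncountable density character of the ball is the cardinality of a
Hilbert basis, and that cardinality determines the space up to isometry. Categoricity follows.

For the second claim, finitely many orthogonality conditions cannot exhaust an infinite-dimensional
real subspace, so saturation yields a realization `x` of norm one orthogonal to all parameters. The
unitary that sends `x` to `ix` and fixes the orthogonal complement of `x` fixes the parameters, so
`ix` is a realization too. The pairs `(x, ix)` and `(ix, x)` are congruent over the reals, but the
complex predicate `‖y₀ + i y₁‖` takes the values `0` and `2` on them, so their types differ. -/

namespace MetricLanguage

variable {L : MetricLanguage.{u, v}}

/-! ### Universal closures and transfer of closed relations -/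

section Semantics

variable {M : Type w} [MetricSpace M] [L.Structure M] {α : Type w'}

/-- The universal closure of a formula with respect to its indexed variables, with `sup` playing
the role of the universal quantifier. -/
def BoundedFormula.sups : ∀ {n : ℕ}, L.BoundedFormula α n → L.Formula α
  | 0, φ => φ
  | _ + 1, φ => φ.sup.sups

theorem BoundedFormula.bddAbove_realize_snoc (a : α → M) {n : ℕ} (φ : L.BoundedFormula α (n + 1))
    (xs : Fin n → M) : BddAbove (Set.range fun x : M => φ.realize a (Fin.snoc xs x)) := by
  obtain ⟨B, hB⟩ := φ.exists_abs_realize_le a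
  exact ⟨B, by rintro _ ⟨x, rfl⟩; exact (abs_le.1 (hB _)).2⟩

theorem BoundedFormula.realize_sup_nonneg {a : α → M} {n : ℕ} {φ : L.BoundedFormula α (n + 1)}
    (hφ : ∀ xs, 0 ≤ φ.realize a xs) (xs : Fin n → M) : 0 ≤ φ.sup.realize a xs :=
  Real.iSup_nonneg fun _ => hφ _

/-- A supremum of nonnegative values vanishes only if every value does. Nonnegativity is what turns
`sup` into a universal quantifier for conditions of the form `φ = 0`. -/
theorem BoundedFormula.realize_sups_eq_zero {a : α → M} {n : ℕ} {φ : L.BoundedFormula α n}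
    (hφ : ∀ xs, 0 ≤ φ.realize a xs) :
    φ.sups.eval a = 0 ↔ ∀ xs, φ.realize a xs = 0 := by
  induction n with
  | zero =>
    exact ⟨fun h xs => by rw [Subsingleton.elim xs Fin.elim0]; exact h, fun h => h _⟩
  | succ n ih =>
    rw [BoundedFormula.sups, ih (realize_sup_nonneg hφ)]
    constructor
    · intro h xs
      refine le_antisymm ?_ (hφ xs)
      rw [← h (Fin.init xs), ← Fin.snoc_init_self xs, Fin.init_snoc]
      exact le_ciSup (φ.bddAbove_realize_snoc a (Fin.init xs)) _
    · intro h xs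
      simp only [realize, h, Real.iSup_const_zero]

/-- A connective applied to a family of formulas indexed by a finite type. -/
noncomputable def BoundedFormula.combine {ι : Type*} [Fintype ι] {n : ℕ} (g : C(ι → ℝ, ℝ))
    (φ : ι → L.BoundedFormula α n) : L.BoundedFormula α n :=
  .conn (g.comp ⟨fun v i => v (Fintype.equivFin ι i), by fun_prop⟩)
    fun i => φ ((Fintype.equivFin ι).symm i)

theorem BoundedFormula.realize_combine {ι : Type*} [Fintype ι] {n : ℕ} (g : C(ι → ℝ, ℝ))
    (φ : ι → L.BoundedFormula α n) (a : α → M) (xs : Fin n → M) :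
    (combine g φ).realize a xs = g fun i => (φ i).realize a xs := by
  simp [combine, realize]

end Semantics

/-- A closed relation between the values of finitely many formulas which holds throughout `N` holds
throughout every model of the theory of `N`. -/
theorem Theory.IsModel.mem_of_isClosed {N : Type w} [MetricSpace N] [L.Structure N] {M : Type w'}
    [MetricSpace M] [L.Structure M] (hM : (L.theoryOf N).IsModel M) {ι : Type*} [Fintype ι] {n : ℕ}
    (φ : ι → L.BoundedFormula Empty n) {P : Set (ι → ℝ)} (hP : IsClosed P)
    (hN : ∀ y : Fin n → N, (fun i => (φ i).realize Empty.elim y) ∈ P) (x : Fin n → M) :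
    (fun i => (φ i).realize Empty.elim x) ∈ P := by
  have hne : P.Nonempty := by
    have : Nonempty N := Structure.nonempty L
    exact ⟨_, hN fun _ => Classical.arbitrary N⟩
  -- The distance to `P` is continuous, nonnegative and, as `P` is closed and nonempty, zero exactly
  -- on `P`.
  set ψ : L.BoundedFormula Empty n :=
    .combine ⟨fun v => Metric.infDist v P, Metric.continuous_infDist_pt P⟩ φ with hψ
  have hN' : ψ.sups.eval (Empty.elim : Empty → N) = 0 := by
    rw [BoundedFormula.realize_sups_eq_zero]
    · intro y
      rw [hψ, BoundedFormula.realize_combine]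
      exact Metric.infDist_zero_of_mem (hN y)
    · intro y
      rw [hψ, BoundedFormula.realize_combine]
      exact Metric.infDist_nonneg
  have hM' : ψ.sups.eval (Empty.elim : Empty → M) = 0 := hM _ hN'
  rw [BoundedFormula.realize_sups_eq_zero] at hM'
  · rw [hP.mem_iff_infDist_zero hne]
    have := hM' x
    rwa [hψ, BoundedFormula.realize_combine] at this
  · intro y
    rw [hψ, BoundedFormula.realize_combine]
    exact Metric.infDist_nonneg

/-! ### Isomorphisms and invariance of formulas -/

section Iso

variable {M : Type w} {N : Type w'} {K : Type*} [MetricSpace M] [MetricSpace N] [MetricSpace K]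
  [L.Structure M] [L.Structure N] [L.Structure K]

theorem Iso.realize_term (e : L.Iso M N) {α : Type*} (a : α → M) (t : L.Term α) :
    t.realize (fun i => e.toFun (a i)) = e.toFun (t.realize a) := by
  induction t with
  | var x => rfl
  | func f ts ih => simp only [Term.realize, ih, e.map_fun]

/-- Isomorphisms preserve the values of formulas. -/
theorem Iso.realize_formula (e : L.Iso M N) {α : Type*} (a : α → M) {n : ℕ}
    (φ : L.BoundedFormula α n) (xs : Fin n → M) :
    φ.realize (fun i => e.toFun (a i)) (fun i => e.toFun (xs i)) = φ.realize a xs := by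
  have hs : ∀ {n : ℕ} (xs : Fin n → M) (x : M),
      (Fin.snoc (fun i => e.toFun (xs i)) (e.toFun x) : Fin (n + 1) → N) =
        fun i => e.toFun ((Fin.snoc xs x : Fin (n + 1) → M) i) := by
    intro n xs x
    funext i
    refine Fin.lastCases ?_ (fun j => ?_) i <;> simp
  have ht : ∀ {n : ℕ} (xs : Fin n → M) (t : L.Term (α ⊕ Fin n)),
      t.realize (Sum.elim (fun i => e.toFun (a i)) fun i => e.toFun (xs i)) =
        e.toFun (t.realize (Sum.elim a xs)) := by
    intro n xs t
    rw [← e.realize_term]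
    congr 1
    funext i
    cases i <;> rfl
  induction φ with
  | dist t₁ t₂ =>
    simp only [BoundedFormula.realize, ht]
    exact e.isometry_toFun.dist_eq _ _
  | pred P ts => simp only [BoundedFormula.realize, ht, e.map_pred]
  | conn g φs ih => simp only [BoundedFormula.realize, ih]
  | sup φ ih =>
    simp only [BoundedFormula.realize]
    -- Surjectivity matters here: the supremum over `N` is reindexed along the bijection.
    refine (e.toEquiv.iSup_congr fun x => ?_).symm
    rw [← ih, ← hs]
    rfl
  | inf φ ih =>
    simp only [BoundedFormula.realize]
    refine (e.toEquiv.iInf_congr fun x => ?_).symm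
    rw [← ih, ← hs]
    rfl

/-- Consequently an automorphism that fixes `A` pointwise maps the realizations of a partial type
over `A` to realizations. -/
theorem Iso.evalOver_eq (e : L.Iso M M) {A : Set M} (he : ∀ x ∈ A, e.toFun x = x) {n : ℕ}
    (φ : L.Formula (A ⊕ Fin n)) (b : Fin n → M) :
    evalOver φ (fun i => e.toFun (b i)) = evalOver φ b := by
  rw [evalOver, evalOver, Formula.eval, Formula.eval, ← e.realize_formula (Sum.elim _ b)]
  congr 1
  · funext i
    rcases i with i | i
    · exact (he _ i.2).symm
    · rfl
  · exact Subsingleton.elim _ _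

/-- The inverse of an isomorphism. -/
def Iso.symm (e : L.Iso M N) : L.Iso N M where
  toIsometryEquiv := e.toIsometryEquiv.symm
  map_fun f x := by
    apply e.toIsometryEquiv.injective
    have := e.map_fun f fun i => e.toIsometryEquiv.symm (x i)
    exact (e.toIsometryEquiv.apply_symm_apply _).trans (Eq.symm (this.trans
      (congrArg _ (funext fun i => e.toIsometryEquiv.apply_symm_apply _))))
  map_pred P x := by
    have := e.map_pred P fun i => e.toIsometryEquiv.symm (x i)
    exact this.symm.trans (congrArg _ (funext fun i => e.toIsometryEquiv.apply_symm_apply _))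

/-- The composition of two isomorphisms. -/
def Iso.trans (e : L.Iso M N) (e' : L.Iso N K) : L.Iso M K where
  toIsometryEquiv := e.toIsometryEquiv.trans e'.toIsometryEquiv
  map_fun f x := (congrArg e'.toFun (e.map_fun f x)).trans (e'.map_fun f _)
  map_pred P x := (e'.map_pred P _).trans (e.map_pred P x)

end Iso

end MetricLanguage

/-! ### Hilbert spaces from positive definite kernels -/

open MetricLanguage
open scoped ComplexConjugate InnerProductSpace

/-- A positive definite complex kernel is the Gram kernel of a total family of vectors in a Hilbert
space. -/
theorem exists_hilbert_of_kernel {M : Type w} (k : M → M → ℂ) (hk : ∀ x y, conj (k y x) = k x y)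
    (hpos : ∀ (n : ℕ) (a : Fin n → ℂ) (x : Fin n → M),
      0 ≤ (∑ i, ∑ j, conj (a i) * a j * k (x i) (x j)).re) :
    ∃ (K : Type w) (_ : NormedAddCommGroup K) (_ : InnerProductSpace ℂ K) (_ : CompleteSpace K)
      (f : M → K), (∀ x y, ⟪f x, f y⟫_ℂ = k x y) ∧
        (Submodule.span ℂ (Set.range f)).topologicalClosure = ⊤ := by
  -- The scalar kernel is viewed as an operator-valued kernel on `ℂ`. The vector attached to `x`
  -- will be the kernel function at `x` applied to `1`.
  let G : Matrix M M (ℂ →L[ℂ] ℂ) := Matrix.of fun x y => k x y • (1 : ℂ →L[ℂ] ℂ)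
  have hG : G.PosSemidef := by
    refine (RKHS.posSemidef_tfae.out 0 2 rfl rfl).2 ⟨?_, ?_⟩
    · ext x y
      simp [G, ← hk x y]
    · intro c
      have hs := hpos c.support.card (fun i => c (c.support.equivFin.symm i))
        fun i => c.support.equivFin.symm i
      have e1 : ∀ F : M → ℂ, ∑ i, F (c.support.equivFin.symm i) = ∑ x ∈ c.support, F x := by
        intro F
        rw [← Finset.sum_coe_sort c.support F]
        exact c.support.equivFin.symm.sum_comp fun x => F x
      have e2 : (∑ i, ∑ j, conj (c (c.support.equivFin.symm i)) * c (c.support.equivFin.symm j) *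
          k (c.support.equivFin.symm i) (c.support.equivFin.symm j)) =
          ∑ x ∈ c.support, ∑ y ∈ c.support, conj (c x) * c y * k x y := by
        rw [← e1 fun x => ∑ y ∈ c.support, conj (c x) * c y * k x y]
        exact Finset.sum_congr rfl fun i _ =>
          e1 fun y => conj (c (c.support.equivFin.symm i)) * c y * k (c.support.equivFin.symm i) y
      rw [e2] at hs
      convert! hs using 2
      rw [Finsupp.sum]
      refine Finset.sum_congr rfl fun x _ => Finset.sum_congr rfl fun y _ => ?_
      simp [G, hk]
      ring
  have : Fact G.PosSemidef := ⟨hG⟩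
  refine ⟨RKHS.OfKernel G, inferInstance, inferInstance, inferInstance,
    fun x => RKHS.kerFun (RKHS.OfKernel G) x 1, fun x y => ?_, ?_⟩
  · rw [← RKHS.kernel_inner, RKHS.OfKernel.kernel_ofKernel]
    simp [G, hk]
  · rw [eq_top_iff, ← RKHS.kerFun_dense (RKHS.OfKernel G)]
    apply Submodule.topologicalClosure_mono
    rw [Submodule.span_le]
    rintro _ ⟨x, v, rfl⟩
    have : RKHS.kerFun (RKHS.OfKernel G) x v = v • RKHS.kerFun (RKHS.OfKernel G) x 1 := by
      rw [← map_smul, smul_eq_mul, mul_one]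
    rw [this]
    exact Submodule.smul_mem _ _ (Submodule.subset_span ⟨x, rfl⟩)

/-! ### Gram data in an abstract model -/

section Axioms

variable {M : Type w} [MetricSpace M] [complexBanach.Structure M]

/-- The interpretation of `s_a`, the norm of a linear combination. -/
noncomputable def combNorm {n : ℕ} (a : Fin n → ℂ) (x : Fin n → M) : ℝ :=
  Structure.predMap (L := complexBanach) a x

/-- The interpretation of `σ_a`, the truncation of a linear combination to the unit ball. -/
noncomputable def ballComb {n : ℕ} (a : Fin n → ℂ) (x : Fin n → M) : M :=
  Structure.funMap (L := complexBanach) (BanachFunc.comb a) x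

/-- The right-hand side of the complex polarization identity. -/
noncomputable def polarization (v : Fin 4 → ℝ) : ℂ :=
  ((v 0 : ℂ) ^ 2 - (v 1 : ℂ) ^ 2 + ((v 2 : ℂ) ^ 2 - (v 3 : ℂ) ^ 2) * Complex.I) / 4

theorem continuous_polarization : Continuous polarization := by
  unfold polarization
  fun_prop

/-- The scalars that occur in the complex polarization identity. -/
noncomputable def polarizationCoeff : Fin 4 → ℂ := ![1, -1, -Complex.I, Complex.I]

/-- The inner product of two elements of the unit ball, read off from the predicates. -/
noncomputable def ballInner (x y : M) : ℂ :=
  polarization fun l => combNorm ![1, polarizationCoeff l] ![x, y]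

/-- The formula expressing the norm of a linear combination of terms. -/
def combFormula {n m : ℕ} (a : Fin m → ℂ) (t : Fin m → complexBanach.Term (Empty ⊕ Fin n)) :
    complexBanach.BoundedFormula Empty n :=
  .pred (L := complexBanach) a t

theorem realize_combFormula {n m : ℕ} (a : Fin m → ℂ)
    (t : Fin m → complexBanach.Term (Empty ⊕ Fin n)) (x : Fin n → M) :
    (combFormula a t).realize Empty.elim x =
      combNorm a fun i => (t i).realize (Sum.elim Empty.elim x) := rfl

theorem combNorm_unitBall {X : Type u} [NormedAddCommGroup X] [NormedSpace ℂ X] [CompleteSpace X]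
    {n : ℕ} (a : Fin n → ℂ) (x : Fin n → UnitBall X) :
    combNorm a x = ‖∑ i, a i • (x i : X)‖ := rfl

theorem coe_ballComb {X : Type u} [NormedAddCommGroup X] [NormedSpace ℂ X] [CompleteSpace X]
    {n : ℕ} (a : Fin n → ℂ) (x : Fin n → UnitBall X) :
    ((ballComb a x : UnitBall X) : X) = radial (∑ i, a i • (x i : X)) := rfl

/-- Polarization. The left side makes sense in every structure of the language, so facts about inner
products can be transferred to abstract models. -/
theorem ballInner_unitBall {X : Type u} [NormedAddCommGroup X] [InnerProductSpace ℂ X]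
    [CompleteSpace X] (x y : UnitBall X) : ballInner x y = ⟪(x : X), y⟫_ℂ := by
  rw [inner_eq_sum_norm_sq_div_four (𝕜 := ℂ) (x : X) y]
  simp [ballInner, polarization, polarizationCoeff, combNorm_unitBall, sub_eq_add_neg]

variable {H : Type u} [NormedAddCommGroup H] [InnerProductSpace ℂ H] [CompleteSpace H]

/-- The formulas that express the norm of a linear combination of the variables and their inner
products. -/
noncomputable def gramFormulas {n : ℕ} (a : Fin n → ℂ) :
    Option (Fin n × Fin n × Fin 4) → complexBanach.BoundedFormula Empty n
  | none => combFormula a fun i => .var (.inr i)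
  | some (i, j, l) => combFormula ![1, polarizationCoeff l] ![.var (.inr i), .var (.inr j)]

/-- The norm and the inner products, recovered from the values of `gramFormulas`. -/
noncomputable def gramOfValues {n : ℕ} (v : Option (Fin n × Fin n × Fin 4) → ℝ) :
    ℝ × (Fin n → Fin n → ℂ) :=
  (v none, fun i j => polarization fun l => v (some (i, j, l)))

theorem continuous_gramOfValues {n : ℕ} : Continuous (gramOfValues (n := n)) := by
  have := continuous_polarization
  unfold gramOfValues
  fun_prop

theorem gramOfValues_realize {n : ℕ} (a : Fin n → ℂ) (x : Fin n → M) :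
    gramOfValues (fun i => (gramFormulas a i).realize Empty.elim x) =
      (combNorm a x, fun i j => ballInner (x i) (x j)) := by
  refine Prod.ext rfl ?_
  funext i j
  simp only [gramOfValues, gramFormulas, realize_combFormula, ballInner]
  congr 1
  funext l
  congr 1
  funext m
  fin_cases m <;> rfl

/-- Transfer of closed relations between inner products and the norm of one linear combination. -/
theorem MetricLanguage.Theory.IsModel.gram_mem (hM : (complexBanach.theoryOf (UnitBall H)).IsModel M)
    {n : ℕ} (a : Fin n → ℂ) {P : Set (ℝ × (Fin n → Fin n → ℂ))} (hP : IsClosed P)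
    (hH : ∀ y : Fin n → UnitBall H,
      (‖∑ i, a i • (y i : H)‖, fun i j => ⟪(y i : H), y j⟫_ℂ) ∈ P) (x : Fin n → M) :
    (combNorm a x, fun i j => ballInner (x i) (x j)) ∈ P := by
  have hN := hM.mem_of_isClosed (gramFormulas a) (P := gramOfValues ⁻¹' P)
    (hP.preimage continuous_gramOfValues) (fun y => ?_) x
  · rwa [Set.mem_preimage, gramOfValues_realize] at hN
  · rw [Set.mem_preimage, gramOfValues_realize, combNorm_unitBall]
    simpa only [ballInner_unitBall] using hH y

/-- Transfer of closed relations between the norm of a linear combination and the norm of its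
combination with its truncation. -/
theorem MetricLanguage.Theory.IsModel.comb_mem
    (hM : (complexBanach.theoryOf (UnitBall H)).IsModel M)
    {n : ℕ} (a : Fin n → ℂ) (c : ℂ) (b : Fin n → ℂ) {P : Set (ℝ × ℝ)} (hP : IsClosed P)
    (hH : ∀ y : Fin n → UnitBall H, (‖∑ i, a i • (y i : H)‖,
      ‖c • radial (∑ i, a i • (y i : H)) + ∑ i, b i • (y i : H)‖) ∈ P) (x : Fin n → M) :
    (combNorm a x, combNorm (Fin.cons c b : Fin (n + 1) → ℂ) (Fin.cons (ballComb a x) x)) ∈ P := by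
  let φ : Fin 2 → complexBanach.BoundedFormula Empty n := ![combFormula a fun i => .var (.inr i),
    combFormula (Fin.cons c b : Fin (n + 1) → ℂ) (Fin.cons
      (.func (L := complexBanach) (BanachFunc.comb a) fun i => .var (.inr i)) fun i => .var (.inr i))]
  have hN := hM.mem_of_isClosed φ (P := (fun v : Fin 2 → ℝ => (v 0, v 1)) ⁻¹' P)
    (hP.preimage (by fun_prop)) (fun y => ?_) x
  · simp only [Set.mem_preimage, φ, realize_combFormula, Matrix.cons_val_zero,
      Matrix.cons_val_one] at hN
    convert! hN using 3
    funext i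
    refine Fin.cases ?_ (fun j => ?_) i <;> rfl
  · simp only [Set.mem_preimage, φ, realize_combFormula, Matrix.cons_val_zero,
      Matrix.cons_val_one, combNorm_unitBall]
    convert! hH y using 3
    simp only [Fin.sum_univ_succ, Fin.cons_zero, Fin.cons_succ]
    rfl

/-- In an abstract structure the metric and the norm predicates are independent data. The theory
ties them together, which makes the representation isometric. -/
theorem MetricLanguage.Theory.IsModel.dist_eq (hM : (complexBanach.theoryOf (UnitBall H)).IsModel M)
    (x y : M) : dist x y = combNorm ![1, -1] ![x, y] := by
  let φ : Fin 2 → complexBanach.BoundedFormula Empty 2 := ![.dist (.var (.inr 0)) (.var (.inr 1)),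
    combFormula ![1, -1] ![.var (.inr 0), .var (.inr 1)]]
  have hN := hM.mem_of_isClosed φ (P := {v | v 0 = v 1})
    (isClosed_eq (by fun_prop) (by fun_prop)) (fun y => ?_) ![x, y]
  · simp only [Set.mem_ofPred_eq, φ, realize_combFormula, Matrix.cons_val_zero,
      Matrix.cons_val_one] at hN
    convert! hN using 2
    funext i
    fin_cases i <;> rfl
  · simp only [Set.mem_ofPred_eq, φ, realize_combFormula, Matrix.cons_val_zero,
      Matrix.cons_val_one, combNorm_unitBall]
    rw [BoundedFormula.realize, Subtype.dist_eq, dist_eq_norm]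
    simp [Fin.sum_univ_two, Term.realize, sub_eq_add_neg]

theorem MetricLanguage.Theory.IsModel.ballZero_eq
    (hM : (complexBanach.theoryOf (UnitBall H)).IsModel M) :
    combNorm ![1] ![ballZero M] = 0 := by
  let φ : Fin 1 → complexBanach.BoundedFormula Empty 0 :=
    ![combFormula ![1] ![.func (L := complexBanach) BanachFunc.zero Fin.elim0]]
  have hN := hM.mem_of_isClosed φ (P := {v | v 0 = 0})
    (isClosed_eq (by fun_prop) (by fun_prop)) (fun y => ?_) Fin.elim0
  · simp only [Set.mem_ofPred_eq, φ, realize_combFormula, Matrix.cons_val_zero] at hN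
    convert! hN using 2
    funext i
    fin_cases i
    exact congrArg (Structure.funMap (L := complexBanach) BanachFunc.zero)
      (Subsingleton.elim (α := Fin 0 → M) _ _)
  · simp only [Set.mem_ofPred_eq, φ, realize_combFormula, Matrix.cons_val_zero, combNorm_unitBall]
    simp
    rfl

end Axioms

theorem continuous_radial {X : Type*} [NormedAddCommGroup X] [NormedSpace ℂ X] :
    Continuous (radial : X → X) := by
  have : LipschitzWith 2 (radial : X → X) := LipschitzWith.of_dist_le_mul fun x y => by
    simpa [dist_eq_norm] using norm_radial_sub_le x y
  exact this.continuous

theorem norm_sum_smul_sq_eq {E : Type*} [NormedAddCommGroup E] [InnerProductSpace ℂ E] {n : ℕ}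
    (a : Fin n → ℂ) (x : Fin n → E) :
    ‖∑ i, a i • x i‖ ^ 2 = (∑ i, ∑ j, conj (a i) * a j * ⟪x i, x j⟫_ℂ).re := by
  rw [← inner_self_eq_norm_sq (𝕜 := ℂ), sum_inner]
  simp only [inner_sum, inner_smul_left, inner_smul_right]
  refine congrArg Complex.re (Finset.sum_congr rfl fun i _ => Finset.sum_congr rfl fun j _ => ?_)
  ring

/-- Tuples with the same Gram matrix have the same norms of linear combinations. -/
theorem norm_sum_smul_congr {E F : Type*} [NormedAddCommGroup E] [InnerProductSpace ℂ E]
    [NormedAddCommGroup F] [InnerProductSpace ℂ F] {n : ℕ} {x : Fin n → E} {y : Fin n → F}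
    (h : ∀ i j, ⟪x i, x j⟫_ℂ = ⟪y i, y j⟫_ℂ) (a : Fin n → ℂ) :
    ‖∑ i, a i • x i‖ = ‖∑ i, a i • y i‖ := by
  rw [← sq_eq_sq₀ (norm_nonneg _) (norm_nonneg _), norm_sum_smul_sq_eq, norm_sum_smul_sq_eq]
  simp only [h]

/-! ### Models are unit balls of Hilbert spaces -/

section Representation

variable {M : Type w} [MetricSpace M] [complexBanach.Structure M]
variable {H : Type u} [NormedAddCommGroup H] [InnerProductSpace ℂ H] [CompleteSpace H]

/-- An isomorphism onto the unit ball of a Banach space, from a map that represents the norms of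
linear combinations and has total range. -/
theorem exists_iso_of_combNorm {K : Type w'} [NormedAddCommGroup K] [NormedSpace ℂ K]
    [CompleteSpace K] (f : M → K)
    (hf : ∀ {n : ℕ} (a : Fin n → ℂ) (x : Fin n → M), ‖∑ i, a i • f (x i)‖ = combNorm a x)
    (hd : (Submodule.span ℂ (Set.range f)).topologicalClosure = ⊤)
    (hdist : ∀ x y, dist (f x) (f y) = dist x y) (h0 : f (ballZero M) = 0)
    (hcomb : ∀ {n : ℕ} (a : Fin n → ℂ) (x : Fin n → M),
      f (ballComb a x) = radial (∑ i, a i • f (x i))) :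
    ∃ e : complexBanach.Iso M (UnitBall K), ∀ x, (e.toFun x : K) = f x := by
  have hiso : Isometry f := Isometry.of_dist_eq hdist
  have hle : ∀ x, ‖f x‖ ≤ 1 := fun x => by
    have h1 := hf ![1] ![x]
    have h2 := Structure.predMap_bound (L := complexBanach) (M := M) (n := 1)
      (![1] : Fin 1 → ℂ) ![x]
    simp only [Fin.sum_univ_one, Matrix.cons_val_zero, one_smul] at h1
    rw [h1]
    refine (le_abs_self _).trans (h2.trans ?_)
    simp [complexBanach]
  have hclosed : IsClosed (Set.range f) := by
    have : CompleteSpace M := Structure.complete complexBanach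
    exact hiso.isClosedEmbedding.isClosed_range
  -- The retraction `radial` sends the span of the range back into the range, by the law for
  -- `ballComb`. By continuity it sends the closure of the span, which is all of `K`, into the
  -- closed range, and it fixes the points of the ball.
  have hsurj : ∀ z : K, ‖z‖ ≤ 1 → z ∈ Set.range f := by
    intro z hz
    have hz' : z ∈ closure (Submodule.span ℂ (Set.range f) : Set K) := by
      rw [← Submodule.topologicalClosure_coe, hd]
      trivial
    rw [← radial_of_norm_le hz, ← hclosed.closure_eq]
    refine map_mem_closure continuous_radial hz' fun y hy => ?_
    obtain ⟨n, a, g, rfl⟩ := Submodule.mem_span_set'.1 hy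
    choose x hx using fun i => (g i).2
    exact ⟨ballComb a x, by simp only [hcomb, hx]⟩
  let F : M → UnitBall K := fun x => ⟨f x, mem_closedBall_zero_iff.2 (hle x)⟩
  have hF : Function.Bijective F := by
    refine ⟨fun x y h => hiso.injective (congrArg Subtype.val h), fun z => ?_⟩
    obtain ⟨x, hx⟩ := hsurj z (mem_closedBall_zero_iff.1 z.2)
    exact ⟨x, Subtype.ext hx⟩
  refine ⟨⟨⟨Equiv.ofBijective F hF, Isometry.of_dist_eq fun x y => hdist x y⟩, ?_, ?_⟩,
    fun x => rfl⟩
  · intro n g x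
    cases g with
    | zero =>
      rw [Subsingleton.elim x Fin.elim0]
      exact Subtype.ext h0
    | comb a => exact Subtype.ext (hcomb a x)
  · intro n a x
    exact hf a x

/-- Every model of the theory of a Hilbert space is the unit ball of a Hilbert space. -/
theorem MetricLanguage.Theory.IsModel.exists_iso_unitBall
    (hM : (complexBanach.theoryOf (UnitBall H)).IsModel M) :
    ∃ (K : Type w) (_ : NormedAddCommGroup K) (_ : InnerProductSpace ℂ K) (_ : CompleteSpace K),
      Nonempty (complexBanach.Iso M (UnitBall K)) := by
  -- The coefficient tuple is `0` because only the inner products enter this relation.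
  have hsymm : ∀ x y : M, conj (ballInner y x) = ballInner x y := fun x y =>
    hM.gram_mem (n := 2) 0 (P := {p | conj (p.2 1 0) = p.2 0 1})
      (isClosed_eq (by fun_prop) (by fun_prop)) (fun y => inner_conj_symm _ _) ![x, y]
  have hsq : ∀ (n : ℕ) (a : Fin n → ℂ) (x : Fin n → M),
      combNorm a x ^ 2 = (∑ i, ∑ j, conj (a i) * a j * ballInner (x i) (x j)).re := fun n a x =>
    hM.gram_mem a (P := {p | p.1 ^ 2 = (∑ i, ∑ j, conj (a i) * a j * p.2 i j).re})
      (isClosed_eq (by fun_prop) (by fun_prop)) (fun y => norm_sum_smul_sq_eq a _) x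
  have hnn : ∀ {n : ℕ} (a : Fin n → ℂ) (x : Fin n → M), 0 ≤ combNorm a x := fun a x =>
    hM.gram_mem a (P := {p | 0 ≤ p.1}) (isClosed_le (by fun_prop) (by fun_prop))
      (fun y => norm_nonneg _) x
  obtain ⟨K, _, _, _, f, hf, hd⟩ := exists_hilbert_of_kernel (ballInner (M := M)) hsymm
    fun n a x => by rw [← hsq]; positivity
  have hnorm : ∀ {n : ℕ} (a : Fin n → ℂ) (x : Fin n → M),
      ‖∑ i, a i • f (x i)‖ = combNorm a x := by
    intro n a x
    rw [← sq_eq_sq₀ (norm_nonneg _) (hnn a x), hsq, norm_sum_smul_sq_eq]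
    simp only [hf]
  suffices h : Nonempty (complexBanach.Iso M (UnitBall K)) from
    ⟨K, inferInstance, inferInstance, inferInstance, h⟩
  refine (exists_iso_of_combNorm f hnorm hd ?_ ?_ ?_).nonempty
  · intro x y
    rw [hM.dist_eq, ← hnorm, dist_eq_norm]
    simp [Fin.sum_univ_two, sub_eq_add_neg]
  · have := hM.ballZero_eq
    rw [← hnorm] at this
    simpa using this
  · intro n a x
    -- Scalars are part of the symbols, so the truncation factor, which depends on `x`, cannot occur
    -- in a single formula. The norm of `σ_a(x) - t ∑ aᵢ xᵢ` is therefore transferred for every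
    -- fixed `t`, and `t` is set to the actual factor afterwards.
    have h1 : ∀ t : ℝ, combNorm (Fin.cons 1 fun i => -(t : ℂ) * a i : Fin (n + 1) → ℂ)
        (Fin.cons (ballComb a x) x) = |(max 1 (combNorm a x))⁻¹ - t| * combNorm a x := by
      intro t
      refine hM.comb_mem a 1 _ (P := {p | p.2 = |(max 1 p.1)⁻¹ - t| * p.1})
        (isClosed_eq (by fun_prop) ?_) (fun y => ?_) x
      · have : Continuous fun p : ℝ × ℝ => (max 1 p.1)⁻¹ :=
          Continuous.inv₀ (by fun_prop) fun p => (lt_max_of_lt_left one_pos).ne'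
        fun_prop
      · simp only [Set.mem_ofPred_eq, mul_smul, ← Finset.smul_sum]
        rw [radial, one_smul, neg_smul, ← sub_eq_add_neg, ← sub_smul, norm_smul,
          ← Complex.ofReal_sub, Complex.norm_real, Real.norm_eq_abs]
    have h2 := h1 (max 1 (combNorm a x))⁻¹
    rw [sub_self, abs_zero, zero_mul, ← hnorm, norm_eq_zero, Fin.sum_univ_succ] at h2
    simp only [Fin.cons_zero, Fin.cons_succ, one_smul, mul_smul, neg_smul,
      Finset.sum_neg_distrib, ← Finset.smul_sum] at h2
    rw [← sub_eq_add_neg, sub_eq_zero] at h2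
    rw [h2, radial, hnorm]

end Representation

/-! ### Back-and-forth between Hilbert spaces -/

theorem sum_smul_sum_smul {E : Type*} [AddCommGroup E] [Module ℂ E] {m n : ℕ} (a : Fin m → ℂ)
    (c : Fin m → Fin n → ℂ) (v : Fin n → E) :
    ∑ i, a i • ∑ j, c i j • v j = ∑ j, (∑ i, a i * c i j) • v j := by
  simp only [Finset.smul_sum, Finset.sum_smul, mul_smul]
  exact Finset.sum_comm

section BackAndForth

variable {H : Type u} [NormedAddCommGroup H] [InnerProductSpace ℂ H]
  {K : Type w} [NormedAddCommGroup K] [InnerProductSpace ℂ K]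

/-- A finite-dimensional subspace has a nonzero orthogonal complement in `K`. This is where infinite
dimension enters the back-and-forth. -/
theorem Submodule.exists_mem_orthogonal_norm_eq (hK : ¬ FiniteDimensional ℂ K)
    (V : Submodule ℂ K) [FiniteDimensional ℂ V] {r : ℝ} (hr : 0 ≤ r) : ∃ z ∈ Vᗮ, ‖z‖ = r := by
  have hV : Vᗮ ≠ ⊥ := by
    rw [Ne, Submodule.orthogonal_eq_bot_iff]
    rintro rfl
    exact hK (Module.Finite.equiv (Submodule.topEquiv (R := ℂ) (M := K)))
  obtain ⟨z, hz, hz0⟩ := Submodule.exists_mem_ne_zero_of_ne_bot hV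
  refine ⟨((r * ‖z‖⁻¹ : ℝ) : ℂ) • z, Submodule.smul_mem _ _ hz, ?_⟩
  rw [norm_smul, Complex.norm_real, Real.norm_of_nonneg (by positivity), mul_assoc,
    inv_mul_cancel₀ (norm_ne_zero_iff.2 hz0), mul_one]

/-- One-point extension of an isometric correspondence between finite tuples. -/
theorem exists_gram_extension (hK : ¬ FiniteDimensional ℂ K) {n : ℕ} {x : Fin n → H}
    {y : Fin n → K} (h : ∀ i j, ⟪x i, x j⟫_ℂ = ⟪y i, y j⟫_ℂ) (z : H) :
    ∃ w : K, (∀ i, ⟪x i, z⟫_ℂ = ⟪y i, w⟫_ℂ) ∧ ⟪z, z⟫_ℂ = ⟪w, w⟫_ℂ := by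
  let V : Submodule ℂ H := Submodule.span ℂ (Set.range x)
  let W : Submodule ℂ K := Submodule.span ℂ (Set.range y)
  have : FiniteDimensional ℂ V := .span_of_finite ℂ (Set.finite_range x)
  have : FiniteDimensional ℂ W := .span_of_finite ℂ (Set.finite_range y)
  -- The component in the span of `x` is copied to `K` with the same coefficients; the orthogonal
  -- component is replaced by any vector of equal norm orthogonal to the span of `y`.
  obtain ⟨p, hp, q, hq, rfl⟩ := V.exists_add_mem_mem_orthogonal z
  obtain ⟨c, rfl⟩ := (Submodule.mem_span_range_iff_exists_fun ℂ).1 hp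
  obtain ⟨r, hr, hqr⟩ := W.exists_mem_orthogonal_norm_eq hK (norm_nonneg q)
  have hxq : ∀ i, ⟪x i, q⟫_ℂ = 0 := fun i =>
    (Submodule.mem_orthogonal V q).1 hq _ (Submodule.subset_span ⟨i, rfl⟩)
  have hyr : ∀ i, ⟪y i, r⟫_ℂ = 0 := fun i =>
    (Submodule.mem_orthogonal W r).1 hr _ (Submodule.subset_span ⟨i, rfl⟩)
  have hqx : ∀ i, ⟪q, x i⟫_ℂ = 0 := fun i => inner_eq_zero_symm.1 (hxq i)
  have hry : ∀ i, ⟪r, y i⟫_ℂ = 0 := fun i => inner_eq_zero_symm.1 (hyr i)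
  have hself : ⟪q, q⟫_ℂ = ⟪r, r⟫_ℂ := by
    rw [inner_self_eq_norm_sq_to_K, inner_self_eq_norm_sq_to_K, hqr]
  refine ⟨∑ i, c i • y i + r, fun i => ?_, ?_⟩
  · simp only [inner_add_right, inner_sum, inner_smul_right, hxq, hyr, h]
  · simp only [inner_add_right, inner_add_left, inner_sum, sum_inner, inner_smul_right,
      inner_smul_left, hxq, hyr, hqx, hry, h, hself]

/-- The extending vector has the norm of `z`, hence stays in the ball over which the quantifiers
range. -/
theorem exists_gram_snoc (hK : ¬ FiniteDimensional ℂ K) {n : ℕ} {x : Fin n → UnitBall H}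
    {y : Fin n → UnitBall K} (h : ∀ i j, ⟪(x i : H), x j⟫_ℂ = ⟪(y i : K), y j⟫_ℂ)
    (z : UnitBall H) : ∃ w : UnitBall K, ∀ i j,
      ⟪((Fin.snoc x z : Fin (n + 1) → UnitBall H) i : H),
          (Fin.snoc x z : Fin (n + 1) → UnitBall H) j⟫_ℂ =
        ⟪((Fin.snoc y w : Fin (n + 1) → UnitBall K) i : K),
          (Fin.snoc y w : Fin (n + 1) → UnitBall K) j⟫_ℂ := by
  obtain ⟨w, hw, hz⟩ := exists_gram_extension hK h (z : H)
  have hw1 : ‖w‖ = ‖(z : H)‖ := by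
    rw [← sq_eq_sq₀ (norm_nonneg _) (norm_nonneg _), ← inner_self_eq_norm_sq (𝕜 := ℂ),
      ← inner_self_eq_norm_sq (𝕜 := ℂ), hz]
  refine ⟨⟨w, mem_closedBall_zero_iff.2 (hw1.trans_le (mem_closedBall_zero_iff.1 z.2))⟩,
    fun i j => ?_⟩
  refine Fin.lastCases ?_ (fun i => ?_) i <;> refine Fin.lastCases ?_ (fun j => ?_) j
  · simpa using hz
  · rw [← inner_conj_symm, ← inner_conj_symm (𝕜 := ℂ) (E := K)]
    simpa using congrArg conj (hw j)
  · simpa using hw i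
  · simpa using h i j

variable [CompleteSpace H] [CompleteSpace K]

/-- Terms take values which are the same linear combinations for tuples with the same Gram
matrix. -/
theorem exists_realize_term_eq_sum {n : ℕ} {x : Fin n → UnitBall H} {y : Fin n → UnitBall K}
    (h : ∀ i j, ⟪(x i : H), x j⟫_ℂ = ⟪(y i : K), y j⟫_ℂ)
    (t : complexBanach.Term (Empty ⊕ Fin n)) :
    ∃ c : Fin n → ℂ, ((t.realize (Sum.elim Empty.elim x) : UnitBall H) : H) = ∑ i, c i • (x i : H) ∧
      ((t.realize (Sum.elim Empty.elim y) : UnitBall K) : K) = ∑ i, c i • (y i : K) := by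
  classical
  induction t with
  | var v =>
    rcases v with v | v
    · exact v.elim
    · exact ⟨Pi.single v 1, by simp [Term.realize, Pi.single_apply],
        by simp [Term.realize, Pi.single_apply]⟩
  | func g ts ih =>
    choose c hx hy using ih
    cases g with
    | zero => exact ⟨0, by simp only [Pi.zero_apply, zero_smul, Finset.sum_const_zero]; rfl,
        by simp only [Pi.zero_apply, zero_smul, Finset.sum_const_zero]; rfl⟩
    | comb a =>
      refine ⟨fun j => ((max 1 ‖∑ j, (∑ i, a i * c i j) • (x j : H)‖)⁻¹ : ℝ) *
        ∑ i, a i * c i j, ?_, ?_⟩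
      · change radial (∑ i, a i • (((ts i).realize (Sum.elim Empty.elim x) : UnitBall H) : H)) = _
        simp only [hx, sum_smul_sum_smul, radial, mul_smul _ (Finset.sum _ _), ← Finset.smul_sum]
      · change radial (∑ i, a i • (((ts i).realize (Sum.elim Empty.elim y) : UnitBall K) : K)) = _
        -- Both truncation factors depend only on the norm of the combination, which the Gram matrix
        -- determines.
        rw [norm_sum_smul_congr h]
        simp only [hy, sum_smul_sum_smul, radial, mul_smul _ (Finset.sum _ _), ← Finset.smul_sum]

theorem combNorm_realize_term_eq {n : ℕ} {x : Fin n → UnitBall H} {y : Fin n → UnitBall K}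
    (h : ∀ i j, ⟪(x i : H), x j⟫_ℂ = ⟪(y i : K), y j⟫_ℂ) {m : ℕ} (a : Fin m → ℂ)
    (ts : Fin m → complexBanach.Term (Empty ⊕ Fin n)) :
    combNorm a (fun i => (ts i).realize (Sum.elim Empty.elim x)) =
      combNorm a fun i => (ts i).realize (Sum.elim Empty.elim y) := by
  choose c hx hy using fun i => exists_realize_term_eq_sum h (ts i)
  simp only [combNorm_unitBall, hx, hy, sum_smul_sum_smul]
  exact norm_sum_smul_congr h _

/-- In infinite-dimensional Hilbert spaces, the value of a formula at a tuple is determined by the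
Gram matrix of the tuple. -/
theorem realize_eq_of_gram_eq (hH : ¬ FiniteDimensional ℂ H) (hK : ¬ FiniteDimensional ℂ K)
    {n : ℕ} (φ : complexBanach.BoundedFormula Empty n) (x : Fin n → UnitBall H)
    (y : Fin n → UnitBall K) (h : ∀ i j, ⟪(x i : H), x j⟫_ℂ = ⟪(y i : K), y j⟫_ℂ) :
    φ.realize Empty.elim x = φ.realize Empty.elim y := by
  -- The two sets of values over all one-point extensions coincide, which settles `sup` and `inf` at
  -- once.
  have hrange : ∀ {n : ℕ} (φ : complexBanach.BoundedFormula Empty (n + 1))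
      (_ : ∀ x y, (∀ i j, ⟪((x : Fin _ → UnitBall H) i : H), x j⟫_ℂ =
        ⟪((y : Fin _ → UnitBall K) i : K), y j⟫_ℂ) →
        φ.realize Empty.elim x = φ.realize Empty.elim y)
      (x : Fin n → UnitBall H) (y : Fin n → UnitBall K)
      (_ : ∀ i j, ⟪(x i : H), x j⟫_ℂ = ⟪(y i : K), y j⟫_ℂ),
      Set.range (fun z => φ.realize Empty.elim (Fin.snoc x z)) =
        Set.range fun z => φ.realize Empty.elim (Fin.snoc y z) := by
    intro n φ ih x y h
    refine Set.Subset.antisymm ?_ ?_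
    · rintro _ ⟨z, rfl⟩
      obtain ⟨w, hw⟩ := exists_gram_snoc hK h z
      exact ⟨w, (ih _ _ hw).symm⟩
    · rintro _ ⟨z, rfl⟩
      obtain ⟨w, hw⟩ := exists_gram_snoc hH (fun i j => (h i j).symm) z
      exact ⟨w, ih _ _ fun i j => (hw i j).symm⟩
  induction φ with
  | dist t₁ t₂ =>
    obtain ⟨c, hx, hy⟩ := exists_realize_term_eq_sum h t₁
    obtain ⟨d, hx', hy'⟩ := exists_realize_term_eq_sum h t₂
    simp only [BoundedFormula.realize, Subtype.dist_eq, dist_eq_norm, hx, hy, hx', hy',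
      ← Finset.sum_sub_distrib, ← sub_smul]
    exact norm_sum_smul_congr h _
  | pred P ts =>
    exact combNorm_realize_term_eq h P ts
  | conn g φs ih =>
    simp only [BoundedFormula.realize]
    exact congrArg g (funext fun i => ih i x y h)
  | sup φ ih => exact congrArg sSup (hrange φ ih x y h)
  | inf φ ih => exact congrArg sInf (hrange φ ih x y h)

/-- Infinite-dimensional Hilbert spaces are elementarily equivalent. -/
theorem isModel_theoryOf_unitBall (hH : ¬ FiniteDimensional ℂ H) (hK : ¬ FiniteDimensional ℂ K) :
    (complexBanach.theoryOf (UnitBall H)).IsModel (UnitBall K) := fun φ hφ =>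
  (realize_eq_of_gram_eq hK hH φ _ _ fun i => i.elim0).trans hφ

end BackAndForth

/-! ### Density characters and Hilbert bases -/

theorem densityCharacter_le {X : Type w} [TopologicalSpace X] {s : Set X} (hs : Dense s) :
    densityCharacter X ≤ #s :=
  csInf_le' ⟨s, hs, rfl⟩

theorem exists_dense_mk_eq_densityCharacter (X : Type w) [TopologicalSpace X] :
    ∃ s : Set X, Dense s ∧ #s = densityCharacter X :=
  csInf_mem (s := {κ | ∃ s : Set X, Dense s ∧ #s = κ}) ⟨_, Set.univ, dense_univ, rfl⟩

theorem densityCharacter_le_of_surjective {X Y : Type w} [TopologicalSpace X] [TopologicalSpace Y]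
    {f : X → Y} (hf : Continuous f) (hs : Function.Surjective f) :
    densityCharacter Y ≤ densityCharacter X := by
  obtain ⟨s, hd, hX⟩ := exists_dense_mk_eq_densityCharacter X
  rw [← hX]
  exact (densityCharacter_le (hs.denseRange.dense_image hf hd)).trans mk_image_le

theorem Homeomorph.densityCharacter_eq {X Y : Type w} [TopologicalSpace X] [TopologicalSpace Y]
    (e : X ≃ₜ Y) : densityCharacter X = densityCharacter Y :=
  le_antisymm (densityCharacter_le_of_surjective e.symm.continuous e.symm.surjective)
    (densityCharacter_le_of_surjective e.continuous e.surjective)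

section Density

variable {K : Type w} [NormedAddCommGroup K] [InnerProductSpace ℂ K] {ι : Type w}

/-- The sums form an additive submonoid whose closure contains every `c • b i`, hence the span of
the basis and its closure. Indexing by lists makes the cardinality bound `max ℵ₀ #ι` immediate. -/
theorem HilbertBasis.dense_range_list_sum (b : HilbertBasis ι ℂ K) :
    DenseRange fun l : List (ℕ × ι) =>
      (l.map fun p => TopologicalSpace.denseSeq ℂ p.1 • b p.2).sum := by
  let g : ℕ × ι → K := fun p => TopologicalSpace.denseSeq ℂ p.1 • b p.2
  let D : AddSubmonoid K :=
    { carrier := Set.range fun l : List (ℕ × ι) => (l.map g).sum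
      zero_mem' := ⟨[], by simp⟩
      add_mem' := by
        rintro _ _ ⟨l, rfl⟩ ⟨m, rfl⟩
        exact ⟨l ++ m, by simp⟩ }
  have hsmul : ∀ (c : ℂ) (i : ι), c • b i ∈ D.topologicalClosure := by
    intro c i
    refine map_mem_closure (f := fun c : ℂ => c • b i) (by fun_prop)
      (TopologicalSpace.denseRange_denseSeq ℂ c) ?_
    rintro _ ⟨n, rfl⟩
    exact ⟨[(n, i)], by simp [g]⟩
  have hspan : ∀ x ∈ Submodule.span ℂ (Set.range b), x ∈ D.topologicalClosure := by
    intro x hx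
    obtain ⟨c, rfl⟩ := (Finsupp.mem_span_range_iff_exists_finsupp).1 hx
    exact sum_mem fun i _ => hsmul _ _
  intro x
  have hx : x ∈ (Submodule.span ℂ (Set.range b)).topologicalClosure := by
    rw [b.dense_span]
    trivial
  exact closure_minimal hspan D.isClosed_topologicalClosure hx

theorem HilbertBasis.densityCharacter_unitBall_le (b : HilbertBasis ι ℂ K) :
    densityCharacter (UnitBall K) ≤ max ℵ₀ #ι := by
  let r : K → UnitBall K := fun x => ⟨radial x, mem_closedBall_zero_iff.2 (norm_radial_le x)⟩
  have hr : Continuous r := continuous_radial.subtype_mk _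
  have hs : Function.Surjective r := fun x =>
    ⟨x, Subtype.ext (radial_of_norm_le (mem_closedBall_zero_iff.1 x.2))⟩
  refine (densityCharacter_le (hs.denseRange.comp b.dense_range_list_sum hr)).trans ?_
  refine mk_range_le.trans ((mk_list_le_max _).trans (max_le (le_max_left _ _) ?_))
  rw [mk_prod, mk_nat, lift_aleph0, lift_uzero]
  exact mul_le_max_of_aleph0_le_left le_rfl

/-- Distinct basis vectors are `√2` apart, so points of a dense set chosen within `1 / 2` of them
are distinct. -/
theorem HilbertBasis.mk_le_densityCharacter_unitBall (b : HilbertBasis ι ℂ K) :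
    #ι ≤ densityCharacter (UnitBall K) := by
  obtain ⟨s, hs, hK⟩ := exists_dense_mk_eq_densityCharacter (UnitBall K)
  rw [← hK]
  have hb : ∀ i, b i ∈ Metric.closedBall (0 : K) 1 := fun i =>
    mem_closedBall_zero_iff.2 (b.orthonormal.1 i).le
  choose d hd hdist using fun i : ι => hs.exists_dist_lt ⟨b i, hb i⟩ (ε := 1 / 2) (by norm_num)
  refine mk_le_of_injective (f := fun i => (⟨d i, hd i⟩ : s)) fun i j hij => ?_
  by_contra hne
  have h1 : ‖b i - b j‖ < 1 := by
    have hd' : d i = d j := congrArg Subtype.val hij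
    have h2 := hdist i
    have h3 := hdist j
    rw [hd'] at h2
    have := dist_triangle_right (⟨b i, hb i⟩ : UnitBall K) ⟨b j, hb j⟩ (d j)
    rw [← dist_eq_norm]
    change dist (b i) (b j) ≤ _ at this
    linarith
  have h4 : ‖b i - b j‖ ^ 2 = 2 := by
    rw [@norm_sub_sq ℂ, b.orthonormal.1, b.orthonormal.1, b.orthonormal.2 hne]
    norm_num
  nlinarith [norm_nonneg (b i - b j)]

/-- The bounds `#ι` and `max ℵ₀ #ι` agree once either cardinal is uncountable. The existence of
models uses the alternative on `#ι`, uniqueness the one on the density character. -/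
theorem HilbertBasis.densityCharacter_unitBall (b : HilbertBasis ι ℂ K)
    (h : ℵ₀ < densityCharacter (UnitBall K) ∨ ℵ₀ < #ι) : densityCharacter (UnitBall K) = #ι := by
  refine le_antisymm ?_ b.mk_le_densityCharacter_unitBall
  have h1 := b.densityCharacter_unitBall_le
  rcases h with h | h
  · rcases le_total ℵ₀ #ι with h2 | h2
    · rwa [max_eq_right h2] at h1
    · rw [max_eq_left h2] at h1
      exact absurd h h1.not_gt
  · rwa [max_eq_right h.le] at h1

end Density

/-! ### Inseparable categoricity -/

section Categoricity

variable {K : Type w} [NormedAddCommGroup K] [InnerProductSpace ℂ K]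
  {K' : Type w'} [NormedAddCommGroup K'] [InnerProductSpace ℂ K']

theorem LinearIsometryEquiv.map_radial (U : K ≃ₗᵢ[ℂ] K') (x : K) : U (radial x) = radial (U x) := by
  rw [radial, radial, map_smul, U.norm_map]

/-- Hilbert spaces with equipotent Hilbert bases are isometric. -/
theorem HilbertBasis.nonempty_linearIsometryEquiv {ι : Type*} {ι' : Type*}
    [CompleteSpace K'] (b : HilbertBasis ι ℂ K) (b' : HilbertBasis ι' ℂ K') (e : ι ≃ ι') :
    Nonempty (K ≃ₗᵢ[ℂ] K') := by
  have h := b'.orthonormal.comp e e.injective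
  let c : HilbertBasis ι ℂ K' := HilbertBasis.mk h (by
    rw [e.surjective.range_comp, b'.dense_span])
  exact ⟨b.repr.trans c.repr.symm⟩

variable [CompleteSpace K] [CompleteSpace K']

/-- A linear isometry between Hilbert spaces restricts to an isomorphism between their unit
balls. -/
theorem LinearIsometryEquiv.exists_iso_unitBall (U : K ≃ₗᵢ[ℂ] K') :
    ∃ e : complexBanach.Iso (UnitBall K) (UnitBall K'), ∀ x, (e.toFun x : K') = U x := by
  have hU : ∀ {n : ℕ} (a : Fin n → ℂ) (x : Fin n → UnitBall K),
      ∑ i, a i • U (x i) = U (∑ i, a i • (x i : K)) := by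
    intro n a x
    simp only [map_sum, map_smul]
  refine exists_iso_of_combNorm (fun x : UnitBall K => U x) ?_ ?_ ?_ ?_ ?_
  · intro n a x
    rw [hU, U.norm_map, combNorm_unitBall]
  · refine (Submodule.eq_top_iff'.2 fun z => Submodule.le_topologicalClosure _ ?_)
    -- Every vector is a multiple of one in the ball, so the ball is total.
    have h : ((max 1 ‖z‖ : ℝ) : ℂ) • radial z = z := by
      rw [radial, smul_smul, ← Complex.ofReal_mul, mul_inv_cancel₀
        (lt_max_of_lt_left one_pos).ne', Complex.ofReal_one, one_smul]
    rw [← h]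
    refine Submodule.smul_mem _ _ (Submodule.subset_span
      ⟨⟨radial (U.symm z), mem_closedBall_zero_iff.2 (norm_radial_le _)⟩, ?_⟩)
    exact (U.map_radial _).trans (by rw [U.apply_symm_apply])
  · exact fun x y => U.dist_map _ _
  · exact U.map_zero
  · intro n a x
    rw [hU, coe_ballComb, U.map_radial]

variable {H : Type u} [NormedAddCommGroup H] [InnerProductSpace ℂ H] [CompleteSpace H]

/-- Existence is witnessed by `ℓ²` over an index set of cardinality `κ`. For uniqueness, both models
are unit balls of Hilbert spaces whose bases have cardinality `κ`. -/
theorem inseparablyCategorical_theoryOf_unitBall (hH : ¬ FiniteDimensional ℂ H) :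
    (complexBanach.theoryOf (UnitBall H)).InseparablyCategorical.{0, 0, w} := by
  intro κ hκ
  constructor
  · let b : HilbertBasis κ.out ℂ (lp (fun _ : κ.out => ℂ) 2) :=
      ⟨LinearIsometryEquiv.refl ℂ _⟩
    have hinf : ¬ FiniteDimensional ℂ (lp (fun _ : κ.out => ℂ) 2) := by
      intro hfin
      have : Finite κ.out := b.orthonormal.linearIndependent.finite
      exact hκ.not_ge (by rw [← mk_out κ]; exact mk_le_aleph0)
    refine ⟨UnitBall (lp (fun _ : κ.out => ℂ) 2), inferInstance, inferInstance,
      isModel_theoryOf_unitBall hH hinf, ?_⟩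
    rw [b.densityCharacter_unitBall (Or.inr (by rwa [mk_out])), mk_out]
  · intro M N _ _ _ _ hM hN hMκ hNκ
    obtain ⟨K, _, _, _, ⟨e⟩⟩ := hM.exists_iso_unitBall
    obtain ⟨K', _, _, _, ⟨e'⟩⟩ := hN.exists_iso_unitBall
    obtain ⟨s, b, -⟩ := exists_hilbertBasis ℂ K
    obtain ⟨s', b', -⟩ := exists_hilbertBasis ℂ K'
    rw [e.toIsometryEquiv.toHomeomorph.densityCharacter_eq] at hMκ
    rw [e'.toIsometryEquiv.toHomeomorph.densityCharacter_eq] at hNκ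
    have h := b.densityCharacter_unitBall (Or.inl (hMκ ▸ hκ))
    have h' := b'.densityCharacter_unitBall (Or.inl (hNκ ▸ hκ))
    obtain ⟨f⟩ := Cardinal.eq.1 (h.symm.trans (hMκ.trans (hNκ.symm.trans h')))
    obtain ⟨U⟩ := b.nonempty_linearIsometryEquiv b' f
    obtain ⟨g, -⟩ := U.exists_iso_unitBall
    exact ⟨(e.trans g).trans e'.symm⟩

end Categoricity

/-! ### Type-definable real subspaces -/

/-- The unitary map that multiplies the unit vector `w` by `i` and fixes its orthogonal
complement. -/
theorem exists_unitary_smul_I {K : Type*} [NormedAddCommGroup K] [InnerProductSpace ℂ K] {w : K}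
    (hw : ‖w‖ = 1) :
    ∃ U : K ≃ₗᵢ[ℂ] K, U w = Complex.I • w ∧ ∀ z, ⟪z, w⟫_ℂ = 0 → U z = z := by
  have hww : ⟪w, w⟫_ℂ = 1 := by simp [inner_self_eq_norm_sq_to_K, hw]
  -- `T c` scales the line of `w` by `c` and fixes its complement, so `T (-i)` inverts `T i`.
  let T : ℂ → K →ₗ[ℂ] K := fun c => LinearMap.id + (c - 1) • (innerₛₗ ℂ w).smulRight w
  have hT : ∀ c z, T c z = z + ((c - 1) * ⟪w, z⟫_ℂ) • w := fun c z => by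
    simp [T, mul_smul]
  have hTT : ∀ c d, c * d = 1 → ∀ z, T c (T d z) = z := by
    intro c d hcd z
    rw [hT, hT, inner_add_right, inner_smul_right, hww, add_assoc, ← add_smul]
    have : (d - 1) * ⟪w, z⟫_ℂ + (c - 1) * (⟪w, z⟫_ℂ + (d - 1) * ⟪w, z⟫_ℂ * 1) =
        (c * d - 1) * ⟪w, z⟫_ℂ := by ring
    rw [this, hcd, sub_self, zero_mul, zero_smul, add_zero]
  have hI : Complex.I * (-Complex.I) = 1 := by simp
  -- The extra terms add up to `(|c|² - 1) |⟪w, z⟫|²`, which vanishes for `c = i`.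
  have hin : ∀ z, ⟪T Complex.I z, T Complex.I z⟫_ℂ = ⟪z, z⟫_ℂ := by
    intro z
    rw [hT, inner_add_left, inner_add_right, inner_add_right, inner_smul_left, inner_smul_right,
      inner_smul_left, inner_smul_right, hww, ← inner_conj_symm z w, map_mul, map_sub, map_one,
      Complex.conj_I]
    linear_combination (-(conj ⟪w, z⟫_ℂ * ⟪w, z⟫_ℂ)) * Complex.I_sq
  refine ⟨⟨LinearEquiv.ofLinearMap (T Complex.I) (T (-Complex.I)) (LinearMap.ext (hTT _ _ hI))
    (LinearMap.ext (hTT _ _ (by rw [mul_comm, hI]))), fun z => ?_⟩, ?_, fun z hz => ?_⟩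
  · rw [← sq_eq_sq₀ (norm_nonneg _) (norm_nonneg _), ← inner_self_eq_norm_sq (𝕜 := ℂ),
      ← inner_self_eq_norm_sq (𝕜 := ℂ)]
    exact congrArg Complex.re (hin z)
  · refine (hT _ _).trans ?_
    rw [hww]
    module
  · refine (hT _ _).trans ?_
    rw [inner_eq_zero_symm.1 hz]
    module

/-- An infinite-dimensional real subspace contains unit vectors orthogonal to finitely many given
vectors. -/
theorem Submodule.exists_norm_eq_one_inner_eq_zero {K : Type*} [NormedAddCommGroup K]
    [InnerProductSpace ℂ K] {V : Submodule ℝ K} (hV : ¬ FiniteDimensional ℝ V) {ι : Type*} [Finite ι] (a : ι → K) :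
    ∃ v ∈ V, ‖v‖ = 1 ∧ ∀ i, ⟪a i, v⟫_ℂ = 0 := by
  -- A real-linear map from `V` to a finite-dimensional space has a nonzero kernel vector. Scalars
  -- are restricted because `V` is only a real subspace.
  let T : V →ₗ[ℝ] ι → ℂ :=
    LinearMap.pi fun i => ((innerₛₗ ℂ (a i)).restrictScalars ℝ).comp V.subtype
  have hT : ¬ Function.Injective T := fun h => hV (Module.Finite.of_injective T h)
  obtain ⟨v, hv, hv0⟩ : ∃ v, T v = 0 ∧ v ≠ 0 := by
    by_contra! h
    exact hT ((injective_iff_map_eq_zero T).2 h)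
  have hn : ‖(v : K)‖ ≠ 0 := by simpa using hv0
  refine ⟨‖(v : K)‖⁻¹ • (v : K), V.smul_mem _ v.2, ?_, fun i => ?_⟩
  · rw [norm_smul, norm_inv, norm_norm, inv_mul_cancel₀ hn]
  · have : ⟪a i, (v : K)⟫_ℂ = 0 := congrFun hv i
    rw [← Complex.coe_smul, inner_smul_right, this, mul_zero]

section Realizations

variable {C : Type w} [MetricSpace C] [complexBanach.Structure C]
  {K : Type w} [NormedAddCommGroup K] [InnerProductSpace ℂ K] [CompleteSpace K]

theorem MetricLanguage.Iso.combNorm_eq (e : complexBanach.Iso C (UnitBall K)) {n : ℕ}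
    (a : Fin n → ℂ) (x : Fin n → C) :
    combNorm a x = ‖∑ i, a i • (e.toFun (x i) : K)‖ :=
  (e.map_pred (n := n) a x).symm

theorem MetricLanguage.Iso.coe_ballZero (e : complexBanach.Iso C (UnitBall K)) :
    (e.toFun (ballZero C) : K) = 0 :=
  congrArg Subtype.val (e.map_fun (n := 0) BanachFunc.zero Fin.elim0)

/-- The image of a real subspace under an isomorphism onto the unit ball of `K` is the unit ball of
a real subspace of `K`. -/
theorem IsRealSubspace.exists_submodule {S : Set C} (hS : IsRealSubspace S)
    (e : complexBanach.Iso C (UnitBall K)) :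
    ∃ V : Submodule ℝ K, ∀ x, x ∈ S ↔ (e.toFun x : K) ∈ V := by
  have h : IsRealSubspace (e.toIsometryEquiv.symm ⁻¹' S) := by
    constructor
    · have : e.toIsometryEquiv.symm (ballZero (UnitBall K)) = ballZero C := by
        rw [IsometryEquiv.symm_apply_eq]
        exact Subtype.ext e.coe_ballZero.symm
      rw [Set.mem_preimage, this]
      exact hS.zero_mem
    · intro n a x hx
      have : e.toIsometryEquiv.symm (realComb a x) =
          realComb a fun i => e.toIsometryEquiv.symm (x i) := e.symm.map_fun _ _
      rw [Set.mem_preimage, this]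
      exact hS.comb_mem a _ hx
  obtain ⟨V, hV⟩ := (isRealSubspace_iff _).1 h
  refine ⟨V, fun x => ?_⟩
  have := Set.ext_iff.1 hV (e.toIsometryEquiv x)
  rw [Set.mem_preimage, e.toIsometryEquiv.symm_apply_apply] at this
  exact this

theorem IsInfiniteDimensional.not_finiteDimensional {S : Set C} (hS : IsInfiniteDimensional S)
    (e : complexBanach.Iso C (UnitBall K)) {V : Submodule ℝ K}
    (hV : ∀ x, x ∈ S ↔ (e.toFun x : K) ∈ V) : ¬ FiniteDimensional ℝ V := by
  rw [← isInfiniteDimensional_iff]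
  intro n
  obtain ⟨x, hx, hi⟩ := hS n
  exact ⟨fun i => e.toFun (x i), fun i => (hV _).1 (hx i), fun a ha =>
    hi a ((e.map_pred (n := n) _ x).symm.trans ha)⟩

/-- The formula `1 - ‖x‖`. -/
noncomputable def unitNormFormula (A : Set C) : complexBanach.Formula (A ⊕ Fin 1) :=
  .conn (k := 1) ⟨fun v => 1 - v 0, by fun_prop⟩ fun _ =>
    .pred (L := complexBanach) (k := 1) (![1] : Fin 1 → ℂ) ![.var (.inl (.inr 0))]

/-- The formula `‖a + u x‖ - ‖a - u x‖` with the parameter `a`. -/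
noncomputable def orthogonalityFormula {A : Set C} (a : A) (u : ℂ) :
    complexBanach.Formula (A ⊕ Fin 1) :=
  .conn (k := 2) ⟨fun v => v 0 - v 1, by fun_prop⟩
    ![.pred (L := complexBanach) (k := 2) (![1, u] : Fin 2 → ℂ)
        ![.var (.inl (.inl a)), .var (.inl (.inr 0))],
      .pred (L := complexBanach) (k := 2) (![1, -u] : Fin 2 → ℂ)
        ![.var (.inl (.inl a)), .var (.inl (.inr 0))]]

theorem evalOver_unitNormFormula (e : complexBanach.Iso C (UnitBall K)) (A : Set C) (x : C) :
    evalOver (unitNormFormula A) (fun _ => x) = 1 - ‖(e.toFun x : K)‖ := by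
  have h : evalOver (unitNormFormula A) (fun _ => x) = 1 - combNorm ![1] ![x] := by
    refine congrArg (fun y => 1 - combNorm ![1] y) (funext fun i => ?_)
    fin_cases i
    rfl
  rw [h, e.combNorm_eq]
  simp

theorem evalOver_orthogonalityFormula (e : complexBanach.Iso C (UnitBall K)) {A : Set C} (a : A)
    (u : ℂ) (x : C) : evalOver (orthogonalityFormula a u) (fun _ => x) =
      ‖(e.toFun a : K) + u • (e.toFun x : K)‖ - ‖(e.toFun a : K) - u • (e.toFun x : K)‖ := by
  have h : evalOver (orthogonalityFormula a u) (fun _ => x) =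
      combNorm ![1, u] ![(a : C), x] - combNorm ![1, -u] ![(a : C), x] := by
    have h2 : ∀ u : ℂ, combNorm ![1, u] (fun i => Term.realize (L := complexBanach)
        (Sum.elim (Sum.elim (fun a : A => (a : C)) fun _ : Fin 1 => x) (Fin.elim0 : Fin 0 → C))
        ((![.var (.inl (.inl a)), .var (.inl (.inr 0))] :
          Fin 2 → complexBanach.Term ((A ⊕ Fin 1) ⊕ Fin 0)) i)) =
        combNorm ![1, u] ![(a : C), x] := by
      intro u
      refine congrArg (combNorm ![1, u]) (funext fun i => ?_)
      fin_cases i <;> rfl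
    rw [← h2, ← h2]
    rfl
  rw [h, e.combNorm_eq, e.combNorm_eq]
  simp [Fin.sum_univ_two, sub_eq_add_neg]

/-- The norms agree exactly when `Re ⟪x, u y⟫ = 0`; `u = 1` and `u = i` detect the real and
imaginary parts. This makes orthogonality to a parameter expressible by conditions. -/
theorem inner_eq_zero_iff_norm_eq {E : Type*} [NormedAddCommGroup E] [InnerProductSpace ℂ E]
    (x y : E) : ⟪x, y⟫_ℂ = 0 ↔ ∀ u : ℂ, ‖x + u • y‖ - ‖x - u • y‖ = 0 := by
  have key : ∀ z : E, ‖x + z‖ - ‖x - z‖ = 0 ↔ (⟪x, z⟫_ℂ).re = 0 := by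
    intro z
    rw [sub_eq_zero, ← sq_eq_sq₀ (norm_nonneg _) (norm_nonneg _), @norm_add_sq ℂ,
      @norm_sub_sq ℂ]
    change _ + 2 * (⟪x, z⟫_ℂ).re + _ = _ - 2 * (⟪x, z⟫_ℂ).re + _ ↔ _
    constructor <;> intro h <;> linarith
  simp only [key, inner_smul_right]
  refine ⟨fun h u => by simp [h], fun h => Complex.ext ?_ ?_⟩
  · simpa using h 1
  · simpa using h Complex.I

/-- In a saturated structure, an infinite-dimensional type-definable real subspace contains a unit
vector orthogonal to the parameters. -/
theorem exists_mem_realizations_orthogonal {κ : Cardinal.{w}}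
    (hC : IsSaturated complexBanach κ C) (e : complexBanach.Iso C (UnitBall K)) {A : Set C}
    (hA : #A < κ) (p : PartialType complexBanach A) (hS : IsRealSubspace p.realizations)
    (hi : IsInfiniteDimensional p.realizations) :
    ∃ x ∈ p.realizations, ‖(e.toFun x : K)‖ = 1 ∧
      ∀ a ∈ A, ⟪(e.toFun a : K), (e.toFun x : K)⟫_ℂ = 0 := by
  obtain ⟨V, hV⟩ := hS.exists_submodule e
  have hfin := hi.not_finiteDimensional e hV
  let q : PartialType complexBanach A :=
    p ∪ {unitNormFormula A} ∪ {φ | ∃ a u, φ = orthogonalityFormula a u}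
  -- For unit vectors realizing `p`, each condition of `q` follows from orthogonality to one vector
  -- (`0` if nothing is needed). A finite part of `q` thus asks for orthogonality to finitely many
  -- vectors and is satisfied exactly.
  have hlocal : ∀ φ ∈ q, ∃ z : K, ∀ x ∈ p.realizations, ‖(e.toFun x : K)‖ = 1 →
      ⟪z, (e.toFun x : K)⟫_ℂ = 0 → evalOver φ (fun _ => x) = 0 := by
    rintro φ ((hφ | rfl) | ⟨a, u, rfl⟩)
    · exact ⟨0, fun x hx _ _ => hx φ hφ⟩
    · exact ⟨0, fun x _ hx _ => by rw [evalOver_unitNormFormula e, hx, sub_self]⟩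
    · refine ⟨e.toFun a, fun x _ _ hx => ?_⟩
      rw [evalOver_orthogonalityFormula e]
      exact (inner_eq_zero_iff_norm_eq _ _).1 hx u
  obtain ⟨x, hx⟩ := hC A hA q fun s hs ε hε => by
    choose z hz using fun φ : s => hlocal φ (hs φ.2)
    obtain ⟨v, hvV, hv1, hv0⟩ := Submodule.exists_norm_eq_one_inner_eq_zero hfin z
    obtain ⟨y, rfl⟩ : ∃ y, (e.toFun y : K) = v :=
      ⟨e.symm.toFun ⟨v, mem_closedBall_zero_iff.2 hv1.le⟩,
        congrArg Subtype.val (e.toIsometryEquiv.apply_symm_apply _)⟩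
    refine ⟨y, fun φ hφ => ?_⟩
    rw [hz ⟨φ, hφ⟩ _ ((hV _).2 hvV) hv1 (hv0 _), abs_zero]
    exact hε.le
  refine ⟨x, fun φ hφ => hx φ (Or.inl (Or.inl hφ)), ?_, fun a ha => ?_⟩
  · have := hx _ (Or.inl (Or.inr rfl))
    rw [evalOver_unitNormFormula e] at this
    linarith
  · refine (inner_eq_zero_iff_norm_eq _ _).2 fun u => ?_
    rw [← hx _ (Or.inr ⟨⟨a, ha⟩, u, rfl⟩), evalOver_orthogonalityFormula e]

/-- A type-definable set that contains a unit vector orthogonal to the parameters is not an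
indiscernible subspace: it contains the product of that vector with `i`. -/
theorem not_isIndiscernibleSubspace_of_orthogonal (e : complexBanach.Iso C (UnitBall K))
    {A : Set C} {p : PartialType complexBanach A} {x : C} (hx : x ∈ p.realizations)
    (hx1 : ‖(e.toFun x : K)‖ = 1) (hxA : ∀ a ∈ A, ⟪(e.toFun a : K), (e.toFun x : K)⟫_ℂ = 0) :
    ¬ IsIndiscernibleSubspace (∅ : Set C) p.realizations := by
  intro h
  obtain ⟨U, hUx, hUA⟩ := exists_unitary_smul_I hx1
  obtain ⟨g₀, hg₀⟩ := U.exists_iso_unitBall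
  let g : complexBanach.Iso C C := (e.trans g₀).trans e.symm
  have hg : ∀ y, (e.toFun (g.toFun y) : K) = U (e.toFun y) := fun y => by
    rw [← hg₀]
    exact congrArg Subtype.val (e.toIsometryEquiv.apply_symm_apply _)
  have hgA : ∀ a ∈ A, g.toFun a = a := fun a ha =>
    e.toIsometryEquiv.injective (Subtype.ext ((hg a).trans (hUA _ (hxA a ha))))
  set x' := g.toFun x
  have hx'p : x' ∈ p.realizations := fun φ hφ => (g.evalOver_eq hgA φ fun _ => x).trans (hx φ hφ)
  have hex' : (e.toFun x' : K) = Complex.I • (e.toFun x : K) := (hg x).trans hUx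
  have hzero : g.toFun (ballZero C) = ballZero C :=
    e.toIsometryEquiv.injective (Subtype.ext (by
      change (e.toFun _ : K) = e.toFun _
      rw [hg, e.coe_ballZero, map_zero]))
  have hd : dist x' (ballZero C) = dist x (ballZero C) := by
    conv_lhs => rw [← hzero]
    exact g.isometry_toFun.dist_eq _ _
  -- Swapping two vectors of equal norm is a congruence, since real distances are symmetric.
  have hcong : IsCongruent ![x, x'] ![x', x] := by
    refine ⟨fun i j => ?_, fun i => ?_⟩
    · fin_cases i <;> fin_cases j <;> simp [dist_comm]
    · fin_cases i <;> simp [hd]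
  have htype := (h.sameType_iff ![x, x'] ![x', x] (fun i => by fin_cases i <;> assumption)
    (fun i => by fin_cases i <;> assumption)).2 hcong
  -- With `x' = ix` the left side is `‖x + i(ix)‖ = 0` and the right side is `‖ix + ix‖ = 2`.
  have hev : combNorm ![1, Complex.I] ![x, x'] = combNorm ![1, Complex.I] ![x', x] :=
    htype (.pred (L := complexBanach) (k := 2) (![1, Complex.I] : Fin 2 → ℂ)
      fun i => .var (.inl (.inr i)))
  rw [e.combNorm_eq, e.combNorm_eq] at hev
  simp only [Fin.sum_univ_two, Matrix.cons_val_zero, Matrix.cons_val_one, hex', one_smul,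
    smul_smul, Complex.I_mul_I, neg_smul, add_neg_cancel, norm_zero] at hev
  rw [← add_smul, norm_smul, hx1, one_mul, ← two_mul] at hev
  simp at hev

end Realizations

theorem mainTheorem4 (H : Type u) [NormedAddCommGroup H] [InnerProductSpace ℂ H] [CompleteSpace H]
    (hH : ¬ FiniteDimensional ℂ H) :
    (complexBanach.theoryOf (UnitBall H)).InseparablyCategorical.{0, 0, w} ∧
    ∀ (C : Type w) [MetricSpace C] [complexBanach.Structure C] (κ : Cardinal.{w}),
      (complexBanach.theoryOf (UnitBall H)).IsMonster κ C →
      ∀ A : Set C, Cardinal.mk A < κ →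
      ∀ p : MetricLanguage.PartialType complexBanach A,
        ¬ (IsIndiscernibleSubspace (∅ : Set C) p.realizations ∧
            IsInfiniteDimensional p.realizations) := by
  refine ⟨inseparablyCategorical_theoryOf_unitBall hH, ?_⟩
  rintro C _ _ κ hC A hA p ⟨hS, hi⟩
  obtain ⟨K, _, _, _, ⟨e⟩⟩ := hC.isModel.exists_iso_unitBall
  obtain ⟨x, hx, hx1, hxA⟩ := exists_mem_realizations_orthogonal hC.isSaturated e hA p
    hS.toIsRealSubspace hi
  exact not_isIndiscernibleSubspace_of_orthogonal e hx hx1 hxA hS
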